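/- **Setting.** Let $\tau\ge 0$ be a number of years. For $t=1,\dots,\tau$ let $F_t$ be the distribution function of a law on $\mathbb N_0=\{0,1,2,\dots\}$, and let $G_t$ be the distribution function of a law on $[0,\infty)$ with Lebesgue density $g_t$. Let $\theta=(\theta_1,\theta_2,\theta_3,\theta_4)\in\mathbb R^4$ satisfy $\theta_1^2+\theta_3^2<1$ and $\theta_2^2+\theta_4^2<1$, and put $$\rho_1=\theta_1\theta_2+\theta_3\theta_4,\quad \rho_2=\theta_2^2+\theta_4^2,\quad \rho_3=\theta_1^2,\quad \rho_4=\theta_1\theta_2,\quad \rho_5=\theta_2^2 .$$ Let $\Phi,\phi$ be the standard normal distribution function and density, with $\Phi(\pm\infty)\in\{0,1\}$, $\Phi^{-1}(0)=-\infty$, $\Phi^{-1}(1)=+\infty$; let $\phi_{\mu,\Sigma}$ be the density of the multivariate normal law $\mathcal N(\mu,\Sigma)$; and for a correlation matrix $\Sigma$ let $C_\Sigma(u)=\Phi_{0,\Sigma}(\Phi^{-1}(u_1),\Phi^{-1}(u_2),\dots)$ be the Gaussian copula, $\Phi_{0,\Sigma}$ being the joint distribution function of $\mathcal N(0,\Sigma)$.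 For $k\in\mathbb N_0^\tau$ let $\Sigma_{(k)}^{(\rho)}$ be the correlation matrix indexed by the components of $(N_1,Y_{1,1},\dots,Y_{1,k_1},\dots,N_\tau,Y_{\tau,1},\dots,Y_{\tau,k_\tau})$ whose diagonal entries are $1$ and whose other entries are: $\rho_1$ between $N_t$ and $Y_{t,j}$; $\rho_2$ between $Y_{t,i}$ and $Y_{t,j}$ with $i\ne j$; and, for $s\neq t$, $\rho_3$ between $N_s$ and $N_t$, $\rho_4$ between $N_s$ and $Y_{t,j}$, and $\rho_5$ between $Y_{s,i}$ and $Y_{t,j}$. Let $\Sigma^{(\rho,\theta)}_{(k)}$ be the matrix obtained by adding a first row and column for a variable $R$, with diagonal entry $1$, entries $\theta_1$ between $R$ and every $N_t$, and entries $\theta_2$ between $R$ and every $Y_{t,j}$. **Model.** The frequencies $N_t$ and severities $Y_{t,1},Y_{t,2},\dots$ are random variables such that for all $k,n\in\mathbb N_0^\tau$ and real $y_{t,j}$ $$P\big(N_t\le n_t,\ Y_{t,j}\le y_{t,j}\ (t\le\tau,\ j\le k_t)\big)=C_{\Sigma^{(\rho)}_{(k)}}\big(F_1(n_1),G_1(y_{1,1}),\dots,G_1(y_{1,k_1}),\dots,F_\tau(n_\tau),G_\tau(y_{\tau,1}),\dots,G_\tau(y_{\tau,k_\tau})\big).$$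 In year $t$ one observes $Z_t=(N_t,Y_{t,1},\dots,Y_{t,N_t})$ (and $Z_t=0$ if $N_t=0$). **Result.** The vector $Z_{(\tau)}=(Z_1,\dots,Z_\tau)$ has a joint density $h$ (with respect to the product over the years of counting measure in $n_t$ and Lebesgue measure in $(y_{t,1},\dots,y_{t,n_t})$), and for almost every $z=(n_t,y_{t,1},\dots,y_{t,n_t})_{t\le\tau}$ $$h(z)=\int_{\mathbb R}\prod_{t=1}^{\tau}\left[g_t^{*}(y_{t,1},\dots,y_{t,n_t}\mid r)\left(\Phi\Big(\frac{\Phi^{-1}(F_t(n_t))-\mu_t}{\sigma_t}\Big)-\Phi\Big(\frac{\Phi^{-1}(F_t(n_t-1))-\mu_t}{\sigma_t}\Big)\right)\right]\phi(r)\,dr ,$$ the integrand being integrable. Here $$g_t^{*}(y_{1},\dots,y_{n}\mid r)=\phi_{\mu^*,\Sigma^*}\big(\Phi^{-1}(G_t(y_{1})),\dots,\Phi^{-1}(G_t(y_{n}))\big)\prod_{j=1}^{n}\frac{g_t(y_{j})}{\phi(\Phi^{-1}(G_t(y_{j})))},$$ with $\mu^*=r\theta_2\mathbf 1_{n}$ and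 $\Sigma^*=(1-\rho_2)I_{n}+(\rho_2-\theta_2^2)J_{n\times n}$ ($J$ the all-ones matrix), and $$\mu_t=(\theta_1,\rho_1,\dots,\rho_1)\,A_{n_t}^{-1}\,\big(r,\Phi^{-1}(G_t(y_{t,1})),\dots,\Phi^{-1}(G_t(y_{t,n_t}))\big)^{\mathrm T},\qquad \sigma_t^2=1-(\theta_1,\rho_1,\dots,\rho_1)\,A_{n_t}^{-1}\,(\theta_1,\rho_1,\dots,\rho_1)^{\mathrm T},\quad \sigma_t\ge 0,$$ where $A_{n}$ is the $(n+1)\times(n+1)$ matrix with ones on the diagonal, $\theta_2$ in the rest of the first row and the first column, and $\rho_2$ elsewhere. Moreover, if $R$ is a random variable on the same probability space such that, for all $k$, the joint distribution function of $(R,N_1,Y_{1,1},\dots,Y_{1,k_1},\dots,N_\tau,Y_{\tau,1},\dots,Y_{\tau,k_\tau})$ is $C_{\Sigma^{(\rho,\theta)}_{(k)}}(\Phi(r),F_1(n_1),G_1(y_{1,1}),\dots,G_\tau(y_{\tau,k_\tau}))$, then for every $t\le\tau$ and $n\in\mathbb N_0$: the function $g_t^*(\cdot\mid r)$ is the conditional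 density of $(Y_{t,1},\dots,Y_{t,n})$ given $R=r$, for almost every $r$; and the above difference of values of $\Phi$, with $n_t=n$, is the conditional probability $P(N_t=n\mid R=r,\,Y_{t,1}=y_1,\dots,Y_{t,n}=y_n)$, for almost every $(r,y_1,\dots,y_n)$ with respect to the law of $(R,Y_{t,1},\dots,Y_{t,n})$. -/

import Mathlib

open MeasureTheory ProbabilityTheory

noncomputable section

namespace CopulaClaims

/-! ### The standard normal and the multivariate normal distribution -/

/-- The standard normal distribution function `Φ`, on the extended reals
(so `Φ (-∞) = 0` and `Φ (+∞) = 1`). -/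
def Phi (x : EReal) : ℝ := (gaussianReal 0 1).real {z : ℝ | (z : EReal) ≤ x}

/-- The standard normal density `φ`. -/
def phi (x : ℝ) : ℝ := gaussianPDFReal 0 1 x

/-- The quantile function `Φ⁻¹ u = inf {x : ℝ | u ≤ Φ x}`, with values in the extended reals
(so `Φ⁻¹ 0 = -∞` and `Φ⁻¹ 1 = +∞`). -/
def PhiInv (u : ℝ) : EReal := sInf ((fun x : ℝ => (x : EReal)) '' {x : ℝ | u ≤ Phi x})

/-- The density `φ_{m, S}` of the normal distribution on `ℝⁿ` with mean `m` and (positive definite)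
covariance matrix `S`. -/
def mvNormalDensity {n : ℕ} (m : Fin n → ℝ) (S : Matrix (Fin n) (Fin n) ℝ) (x : Fin n → ℝ) : ℝ :=
  (√((2 * Real.pi) ^ n * S.det))⁻¹ *
    Real.exp (-(dotProduct (x - m) (S⁻¹.mulVec (x - m))) / 2)

/-- The Gaussian copula with correlation matrix `S`:
`C_S(u) = Φ_{0,S}(Φ⁻¹(u_i), i ∈ ι)`, where `Φ_{0,S}` is the joint distribution function of the
centred normal distribution with covariance matrix `S`. -/
def gaussianCopula {ι : Type*} [Fintype ι] [DecidableEq ι] (S : Matrix ι ι ℝ) (u : ι → ℝ) : ℝ :=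
  (multivariateGaussian 0 S).real {x | ∀ i, (x i : EReal) ≤ PhiInv (u i)}

/-! ### Correlation matrices -/

/-- The five correlations `ρ₁, …, ρ₅`. -/
structure Correlations where
  /-- frequency and severity, same year -/
  ρ₁ : ℝ
  /-- two distinct severities, same year -/
  ρ₂ : ℝ
  /-- frequencies, different years -/
  ρ₃ : ℝ
  /-- frequency and severity, different years -/
  ρ₄ : ℝ
  /-- severities, different years -/
  ρ₅ : ℝ

/-- The parameters `θ₁, …, θ₄`. -/
structure FactorParams where
  θ₁ : ℝ
  θ₂ : ℝ
  θ₃ : ℝ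
  θ₄ : ℝ

/-- The reparametrization of the correlations by `θ`. -/
structure Reparametrized (ρ : Correlations) (θ : FactorParams) : Prop where
  eq₁ : ρ.ρ₁ = θ.θ₁ * θ.θ₂ + θ.θ₃ * θ.θ₄
  eq₂ : ρ.ρ₂ = θ.θ₂ ^ 2 + θ.θ₄ ^ 2
  eq₃ : ρ.ρ₃ = θ.θ₁ ^ 2
  eq₄ : ρ.ρ₄ = θ.θ₁ * θ.θ₂
  eq₅ : ρ.ρ₅ = θ.θ₂ ^ 2

/-- Positions in the vector `(N_1, Y_{1,1}, …, Y_{1,k_1}, …, N_τ, Y_{τ,1}, …, Y_{τ,k_τ})`: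
`⟨t, 0⟩` is the place of `N_t`, and `⟨t, j⟩` with `j ≥ 1` that of the `j`-th severity of year `t`. -/
abbrev Position {τ : ℕ} (k : Fin τ → ℕ) : Type := (t : Fin τ) × Fin (k t + 1)

/-- The matrix `Σ_{tt}` of size `n + 1`: ones on the diagonal, `a` in the rest of the first row and
of the first column, `b` elsewhere. -/
def yearMatrix (a b : ℝ) (n : ℕ) : Matrix (Fin (n + 1)) (Fin (n + 1)) ℝ :=
  Matrix.of fun l m => if l = m then 1 else if l ≠ 0 ∧ m ≠ 0 then b else a

/-- The matrix `Σ_{tj}`, `t ≠ j`, of size `(n + 1) × (m + 1)`. -/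
def crossMatrix (ρ : Correlations) (n m : ℕ) : Matrix (Fin (n + 1)) (Fin (m + 1)) ℝ :=
  Matrix.of fun l i =>
    if l = 0 ∧ i = 0 then ρ.ρ₃ else if l ≠ 0 ∧ i ≠ 0 then ρ.ρ₅ else ρ.ρ₄

/-- The partitioned correlation matrix `Σ_{(k)}^{(ρ)}` of all frequencies and severities. -/
def claimMatrix {τ : ℕ} (ρ : Correlations) (k : Fin τ → ℕ) :
    Matrix (Position k) (Position k) ℝ :=
  Matrix.of fun p q =>
    if h : q.1 = p.1 then
      yearMatrix ρ.ρ₁ ρ.ρ₂ (k p.1) p.2 (Fin.cast (by rw [h]) q.2)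
    else crossMatrix ρ (k p.1) (k q.1) p.2 q.2

/-- The partitioned matrix `Σ_{(k)}^{(ρ,θ)}` with the random effect in the first place. -/
def factorMatrix {τ : ℕ} (ρ : Correlations) (θ : FactorParams) (k : Fin τ → ℕ) :
    Matrix (Unit ⊕ Position k) (Unit ⊕ Position k) ℝ :=
  let Ω : Matrix Unit (Position k) ℝ := Matrix.of fun _ p => if p.2 = 0 then θ.θ₁ else θ.θ₂
  Matrix.fromBlocks 1 Ω Ω.transpose (claimMatrix ρ k)

/-! ### Marginal distributions -/

/-- The distribution function on `ℝ` of an integer-valued variable with mass function `f`. -/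
def freqCDF (f : PMF ℕ) (x : ℝ) : ℝ := cdf (f.toMeasure.map (fun n : ℕ => (n : ℝ))) x

/-- `g` is a probability density of a non-negative real random variable. -/
structure IsSeverityDensity (g : ℝ → ℝ) : Prop where
  measurable : Measurable g
  nonneg : ∀ y, 0 ≤ g y
  ae_zero_of_neg : ∀ᵐ y : ℝ, y < 0 → g y = 0
  lintegral_eq_one : ∫⁻ y, ENNReal.ofReal (g y) = 1

/-- The distribution function with density `g`. -/
def sevCDF (g : ℝ → ℝ) (y : ℝ) : ℝ := cdf (volume.withDensity fun x => ENNReal.ofReal (g x)) y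

/-- The vector `(F_1(n_1), G_1(y_{1,1}), …, G_1(y_{1,k_1}), …, F_τ(n_τ), …, G_τ(y_{τ,k_τ}))`. -/
def levels {τ : ℕ} (f : Fin τ → PMF ℕ) (g : Fin τ → ℝ → ℝ) {k : Fin τ → ℕ}
    (n : Fin τ → ℕ) (y : (t : Fin τ) → Fin (k t) → ℝ) (p : Position k) : ℝ :=
  Fin.cases (motive := fun _ => ℝ) (freqCDF (f p.1) (n p.1))
    (fun j => sevCDF (g p.1) (y p.1 j)) p.2

/-! ### The models -/

section Models

variable {Ω : Type*} [MeasurableSpace Ω] {τ : ℕ}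

/-- The Gaussian copula model for frequencies `N t` and severities `Y t 0, Y t 1, …`, of which only
the first `N t` are observed: for all numbers `k_1, …, k_τ` of severities, the joint distribution
function of `(N_t, Y_{t,1}, …, Y_{t,k_t})_{t ≤ τ}` is the Gaussian copula with correlation matrix
`Σ_{(k)}^{(ρ)}` at the marginal distribution functions. -/
structure GaussianCopulaModel (P : Measure Ω) (N : Fin τ → Ω → ℕ) (Y : Fin τ → ℕ → Ω → ℝ)
    (f : Fin τ → PMF ℕ) (g : Fin τ → ℝ → ℝ) (ρ : Correlations) : Prop where
  measurable_freq : ∀ t, Measurable (N t)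
  measurable_sev : ∀ t j, Measurable (Y t j)
  jointCDF : ∀ (k n : Fin τ → ℕ) (y : (t : Fin τ) → Fin (k t) → ℝ),
    P.real {ω | ∀ t, N t ω ≤ n t ∧ ∀ j : Fin (k t), Y t j ω ≤ y t j} =
      gaussianCopula (claimMatrix ρ k) (levels f g n y)

/-- The factor copula model: the joint distribution function of the random effect `R` together
with the frequencies and severities is the Gaussian copula with correlation matrix
`Σ_{(k)}^{(ρ,θ)}` at the marginal distribution functions, that of `R` being `Φ`. -/
structure FactorCopulaModel (P : Measure Ω) (R : Ω → ℝ) (N : Fin τ → Ω → ℕ)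
    (Y : Fin τ → ℕ → Ω → ℝ) (f : Fin τ → PMF ℕ) (g : Fin τ → ℝ → ℝ)
    (ρ : Correlations) (θ : FactorParams) : Prop where
  measurable_effect : Measurable R
  measurable_freq : ∀ t, Measurable (N t)
  measurable_sev : ∀ t j, Measurable (Y t j)
  jointCDF : ∀ (r : ℝ) (k n : Fin τ → ℕ) (y : (t : Fin τ) → Fin (k t) → ℝ),
    P.real {ω | R ω ≤ r ∧ ∀ t, N t ω ≤ n t ∧ ∀ j : Fin (k t), Y t j ω ≤ y t j} =
      gaussianCopula (factorMatrix ρ θ k) (Sum.elim (fun _ => Phi r) (levels f g n y))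

/-! ### Observed claims and their reference measure -/

/-- One year of claims: the number `n` of claims and the vector of the `n` severities. -/
abbrev YearClaims : Type := (n : ℕ) × (Fin n → ℝ)

/-- The observed claims `Z_(τ) = (Z_1, …, Z_τ)`, `Z_t = (N_t, Y_{t,1}, …, Y_{t,N_t})`. -/
def observedClaims (N : Fin τ → Ω → ℕ) (Y : Fin τ → ℕ → Ω → ℝ) (ω : Ω) : Fin τ → YearClaims :=
  fun t => ⟨N t ω, fun j => Y t j ω⟩

/-- Counting measure in the number `n` of claims and Lebesgue measure in the `n` severities. -/
def yearMeasure : Measure YearClaims :=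
  Measure.sum fun n : ℕ => (volume : Measure (Fin n → ℝ)).map (Sigma.mk n)

/-- The reference measure for densities of `Z_(τ)`. -/
def claimsMeasure (τ : ℕ) : Measure (Fin τ → YearClaims) := Measure.pi fun _ => yearMeasure

end Models

/-! ### The explicit expressions -/

/-- The normal scores `Φ⁻¹(G(y_j))`, as real numbers. They are finite except for `y_j` with
`G(y_j) ∈ {0, 1}`, which almost everywhere have `g(y_j) = 0`. -/
def scores (g : ℝ → ℝ) {n : ℕ} (y : Fin n → ℝ) (j : Fin n) : ℝ := (PhiInv (sevCDF g (y j))).toReal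

/-- The density `g^{[joint]*}(y | r)` of the severities of a year conditional on `R = r`. -/
def condSevDensity (ρ : Correlations) (θ : FactorParams) (g : ℝ → ℝ) {n : ℕ}
    (r : ℝ) (y : Fin n → ℝ) : ℝ :=
  mvNormalDensity (fun _ => r * θ.θ₂)
      ((1 - ρ.ρ₂) • (1 : Matrix (Fin n) (Fin n) ℝ)
        + (ρ.ρ₂ - θ.θ₂ ^ 2) • Matrix.of fun _ _ => (1 : ℝ))
      (scores g y)
    * ∏ j, g (y j) / phi (scores g y j)

/-- The vector `(θ₁, ρ₁, …, ρ₁)` of length `n + 1`. -/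
def freqCov (ρ : Correlations) (θ : FactorParams) (n : ℕ) : Fin (n + 1) → ℝ :=
  Fin.cons θ.θ₁ fun _ => ρ.ρ₁

/-- The conditional mean `μ_t`. -/
def condMean (ρ : Correlations) (θ : FactorParams) (g : ℝ → ℝ) {n : ℕ}
    (r : ℝ) (y : Fin n → ℝ) : ℝ :=
  dotProduct (freqCov ρ θ n) ((yearMatrix θ.θ₂ ρ.ρ₂ n)⁻¹.mulVec (Fin.cons r (scores g y)))

/-- The conditional variance `σ_t²`. -/
def condVar (ρ : Correlations) (θ : FactorParams) (n : ℕ) : ℝ :=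
  1 - dotProduct (freqCov ρ θ n) ((yearMatrix θ.θ₂ ρ.ρ₂ n)⁻¹.mulVec (freqCov ρ θ n))

/-- `Φ((Φ⁻¹(F(n)) - μ_t)/σ_t) - Φ((Φ⁻¹(F(n-1)) - μ_t)/σ_t)`. -/
def condFreqProb (ρ : Correlations) (θ : FactorParams) (f : PMF ℕ) (g : ℝ → ℝ) {n : ℕ}
    (r : ℝ) (y : Fin n → ℝ) : ℝ :=
  Phi ((PhiInv (freqCDF f n) - (condMean ρ θ g r y : EReal)) / (√(condVar ρ θ n) : EReal))
    - Phi ((PhiInv (freqCDF f (n - 1)) - (condMean ρ θ g r y : EReal))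
        / (√(condVar ρ θ n) : EReal))

/-- The integrand of the joint density of `Z_(τ)` at `z = (n_t, y_t)_t`, as a function of `r`. -/
def densityIntegrand {τ : ℕ} (ρ : Correlations) (θ : FactorParams) (f : Fin τ → PMF ℕ)
    (g : Fin τ → ℝ → ℝ) (z : Fin τ → YearClaims) (r : ℝ) : ℝ :=
  (∏ t, condSevDensity ρ θ (g t) r (z t).2 * condFreqProb ρ θ (f t) (g t) r (z t).2) * phi r

end CopulaClaims

end

namespace CopulaClaims

open Set MeasurableSpace

/-! ### Products of measures -/

/-! The reparametrization turns the Gaussian copula into a one-factor model. Every block of the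
correlation matrix between two different years has rank one: it is the product of the correlations
with `R` (`claimMatrix_apply_ne`). Hence, given `R = r`, the latent normal variables of different
years are independent. Within a year the latent severities are normal with mean `r θ₂` and
covariance `sevCov`, and the latent frequency is its regression `latentMean` on `r` and these
severities plus an independent normal error of variance `condVar`. This representation is proved by
characteristic functions (`map_latent_noise`). Behind it is the splitting of the quadratic form into
a square for `R` and one nonnegative form per year (`factorMatrix_quadForm`, `yearForm_eq`), which
also shows that the matrix is positive semidefinite.

The passage to claims compares distribution functions; no latent variables are built on `Ω`. The
copula at the levels `F(n)`, `G(y)` is the probability that `Φ` of each latent variable stays below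
its level. For fixed `r` this factors over the years. In one year (`yearNoise_latentYear`),
integrating out the frequency error gives `Φ((Φ⁻¹(F(m)) - μ)/σ)`, the telescoped sum of the
conditional probabilities of `0, …, m` claims, and the normal scores carry the integral over latent
severities to an integral in `y` with density `condSevDensity`. The score map need not be injective:
it is enough that it sends the severity law to the standard normal law. So the copula gives the
values of `claimsLaw` on lower orthants, which determine a finite measure; the model with `R` has
law `claimsLaw`, the model without `R` its second marginal.

An event `N_t = n_t`, `(Y_{t,1}, …, Y_{t,n_t}) ∈ A_t` for all `t` involves only `n_t` severities of
year `t`, so the law with `k = n` evaluates it, and Tonelli's theorem yields the density. For the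
conditional laws, `claimsLaw` restricted to one year disintegrates into the law of `R`, then
`sevKernel`, then `freqKernel`, and disintegrations are almost everywhere unique. -/

theorem lintegral_fin_prod_eq_prod {n : ℕ} {E : Fin n → Type*} {mE : ∀ i, MeasurableSpace (E i)}
    (μ : (i : Fin n) → Measure (E i)) [∀ i, SigmaFinite (μ i)]
    (f : (i : Fin n) → E i → ENNReal) (hf : ∀ i, Measurable (f i)) :
    ∫⁻ x, ∏ i, f i (x i) ∂(Measure.pi μ) = ∏ i, ∫⁻ x, f i x ∂(μ i) := by
  induction n with
  | zero => simp
  | succ n ih =>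
    rw [← ((measurePreserving_piFinSuccAbove μ 0).symm).lintegral_comp_emb
      (MeasurableEquiv.measurableEmbedding _)]
    simp_rw [MeasurableEquiv.piFinSuccAbove_symm_apply, Fin.insertNthEquiv,
      Fin.prod_univ_succ, Fin.insertNth_zero, Equiv.coe_fn_mk, Fin.cons_succ,
      Fin.zero_succAbove, Fin.cons_zero]
    rw [← ih (fun i => μ i.succ) (fun i => f i.succ) fun i => hf _]
    exact lintegral_prod_mul (μ := μ 0) (ν := Measure.pi fun i => μ i.succ) (f := f 0) (g := fun x : (i : Fin n) → E i.succ =>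
      ∏ i, f i.succ (x i)) (hf 0).aemeasurable (Finset.measurable_prod _ fun i _ => (hf _).comp (measurable_pi_apply i)).aemeasurable

theorem pi_withDensity_fin {n : ℕ} {E : Fin n → Type*} {mE : ∀ i, MeasurableSpace (E i)}
    (μ : (i : Fin n) → Measure (E i)) [∀ i, SigmaFinite (μ i)]
    (f : (i : Fin n) → E i → ENNReal) (hf : ∀ i, Measurable (f i))
    [∀ i, SigmaFinite ((μ i).withDensity (f i))] :
    Measure.pi (fun i => (μ i).withDensity (f i)) =
      (Measure.pi μ).withDensity fun x => ∏ i, f i (x i) := by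
  refine Measure.pi_eq fun s hs => ?_
  rw [withDensity_apply _ (MeasurableSet.univ_pi hs), Measure.restrict_pi_pi,
    lintegral_fin_prod_eq_prod _ _ hf]
  simp_rw [withDensity_apply _ (hs _)]

/-! ### Determining classes -/

/-- A class of sets on which locally finite measures are determined. -/
structure IsDetermining {α : Type*} [m : MeasurableSpace α] (C : Set (Set α)) : Prop where
  isPiSystem : IsPiSystem C
  spanning : IsCountablySpanning C
  generateFrom_eq : generateFrom C = m

theorem IsDetermining.ext {α : Type*} [MeasurableSpace α] {C : Set (Set α)}
    (hC : IsDetermining C) {μ ν : Measure α} [IsFiniteMeasure μ] (h : ∀ s ∈ C, μ s = ν s) :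
    μ = ν := by
  obtain ⟨B, hB, hU⟩ := hC.spanning
  exact Measure.ext_of_generateFrom_of_iUnion C B hC.generateFrom_eq.symm hC.isPiSystem hU hB
    (fun _ => measure_ne_top _ _) h

theorem IsDetermining.prod {α β : Type*} [MeasurableSpace α] [MeasurableSpace β]
    {C : Set (Set α)} {D : Set (Set β)} (hC : IsDetermining C) (hD : IsDetermining D) :
    IsDetermining (image2 (· ×ˢ ·) C D) where
  isPiSystem := hC.isPiSystem.prod hD.isPiSystem
  spanning := hC.spanning.prod hD.spanning
  generateFrom_eq :=
    generateFrom_eq_prod hC.generateFrom_eq hD.generateFrom_eq hC.spanning hD.spanning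

theorem IsDetermining.pi {ι : Type*} [Finite ι] {α : ι → Type*} [∀ i, MeasurableSpace (α i)]
    {C : ∀ i, Set (Set (α i))} (hC : ∀ i, IsDetermining (C i)) :
    IsDetermining (Set.pi univ '' Set.pi univ C) where
  isPiSystem := IsPiSystem.pi fun i => (hC i).isPiSystem
  spanning := IsCountablySpanning.pi fun i => (hC i).spanning
  generateFrom_eq := generateFrom_eq_pi (fun i => (hC i).generateFrom_eq) fun i => (hC i).spanning

theorem isDetermining_measurableSet {α : Type*} [MeasurableSpace α] :
    IsDetermining {s : Set α | MeasurableSet s} where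
  isPiSystem := isPiSystem_measurableSet
  spanning := isCountablySpanning_measurableSet
  generateFrom_eq := generateFrom_measurableSet

theorem isDetermining_Iic_real : IsDetermining (range (Iic : ℝ → Set ℝ)) where
  isPiSystem := by rw [← image_univ]; exact isPiSystem_image_Iic _
  spanning := ⟨fun n : ℕ => Iic (n : ℝ), fun n => mem_range_self _, by
    ext x
    simpa using exists_nat_ge x⟩
  generateFrom_eq := (borel_eq_generateFrom_Iic ℝ).symm.trans (BorelSpace.measurable_eq).symm

theorem isDetermining_Iic_nat : IsDetermining (range (Iic : ℕ → Set ℕ)) where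
  isPiSystem := by rw [← image_univ]; exact isPiSystem_image_Iic _
  spanning := ⟨fun n : ℕ => Iic n, fun n => mem_range_self _, iUnion_Iic⟩
  generateFrom_eq := (borel_eq_generateFrom_Iic ℕ).symm.trans (BorelSpace.measurable_eq).symm

theorem isDetermining_Iic_pi {n : ℕ} : IsDetermining (range (Iic : (Fin n → ℝ) → Set (Fin n → ℝ))) := by
  have h := IsDetermining.pi fun _ : Fin n => isDetermining_Iic_real
  convert! h using 1
  ext s
  simp only [mem_range, mem_image, mem_univ_pi]
  constructor
  · rintro ⟨y, rfl⟩
    exact ⟨fun i => Iic (y i), fun i => ⟨y i, rfl⟩, pi_univ_Iic y⟩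
  · rintro ⟨x, hx, rfl⟩
    choose y hy using hx
    refine ⟨y, ?_⟩
    rw [← pi_univ_Iic]
    simp [hy]

/-- Measurable sets in a single summand form a determining class of a countable disjoint union. -/
theorem isDetermining_sigma {α : ℕ → Type*} [∀ n, MeasurableSpace (α n)] :
    IsDetermining {s : Set (Σ n, α n) | ∃ n, ∃ A : Set (α n), MeasurableSet A ∧ s = Sigma.mk n '' A} where
  isPiSystem := by
    rintro _ ⟨n, A, hA, rfl⟩ _ ⟨m, B, hB, rfl⟩ ⟨_, ⟨x, hx, rfl⟩, ⟨y, hy, hxy⟩⟩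
    obtain rfl : m = n := congrArg Sigma.fst hxy
    exact ⟨m, A ∩ B, hA.inter hB, (image_inter sigma_mk_injective).symm⟩
  spanning := ⟨fun n => Sigma.mk n '' univ, fun n => ⟨n, univ, MeasurableSet.univ, rfl⟩, by
    ext ⟨n, x⟩
    simp⟩
  generateFrom_eq := by
    refine le_antisymm (generateFrom_le ?_) fun s hs => ?_
    · rintro _ ⟨n, A, hA, rfl⟩
      refine measurableSet_iInf.2 fun m => ?_
      change MeasurableSet (Sigma.mk m ⁻¹' (Sigma.mk n '' A))
      by_cases h : n = m
      · subst h
        rwa [preimage_image_eq _ sigma_mk_injective]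
      · rw [preimage_image_sigmaMk_of_ne (fun h' => h h'.symm)]
        exact MeasurableSet.empty
    · have : s = ⋃ n, Sigma.mk n '' (Sigma.mk n ⁻¹' s) := by
        ext ⟨n, x⟩
        simp only [mem_iUnion, mem_image, mem_preimage]
        exact ⟨fun h => ⟨n, x, h, rfl⟩, fun ⟨_, _, h, h'⟩ => h' ▸ h⟩
      rw [this]
      refine @MeasurableSet.iUnion _ _ (generateFrom _) _ _ fun n => ?_
      exact measurableSet_generateFrom ⟨n, _, measurableSet_iInf.1 hs n, rfl⟩

/-! ### Measurability on a disjoint union -/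

theorem measurable_sigma_mk {α : ℕ → Type*} [∀ n, MeasurableSpace (α n)] (n : ℕ) :
    Measurable (Sigma.mk n : α n → Σ n, α n) :=
  fun _ hs => measurableSet_iInf.1 hs n

theorem measurable_sigma {α : ℕ → Type*} [∀ n, MeasurableSpace (α n)] {β : Type*}
    [MeasurableSpace β] {F : (Σ n, α n) → β} (hF : ∀ n, Measurable fun x : α n => F ⟨n, x⟩) :
    Measurable F := fun _ hs => measurableSet_iInf.2 fun n => hF n hs

/-- Joint measurability on the product with a disjoint union. -/
theorem measurable_prod_sigma {α : ℕ → Type*} [∀ n, MeasurableSpace (α n)] [∀ n, Nonempty (α n)]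
    {γ β : Type*} [MeasurableSpace γ] [MeasurableSpace β] {F : γ × (Σ n, α n) → β}
    (hF : ∀ n, Measurable fun x : γ × α n => F (x.1, ⟨n, x.2⟩)) : Measurable F := by
  classical
  intro s hs
  -- A measurable retraction onto the `n`-th summand, arbitrary off it. It reads off the fibre
  -- coordinate where the index is `n`, so the preimage splits into countably many measurable
  -- pieces.
  let p : ∀ n, (Σ n, α n) → α n := fun n z =>
    if h : z.1 = n then h ▸ z.2 else Classical.arbitrary _
  have hp : ∀ n, Measurable (p n) := fun n => measurable_sigma fun m => by
    by_cases h : m = n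
    · subst h; simpa [p] using measurable_id'
    · simp [p, h]
  have : F ⁻¹' s = ⋃ n, {z | z.2.1 = n ∧ F (z.1, ⟨n, p n z.2⟩) ∈ s} := by
    ext ⟨c, m, x⟩
    simp [p]
  rw [this]
  refine MeasurableSet.iUnion fun n => ?_
  have h1 : Measurable fun z : γ × (Σ n, α n) => z.2.1 :=
    (measurable_sigma (F := Sigma.fst) fun m => measurable_const).comp measurable_snd
  exact (h1 (measurableSet_singleton n)).inter
    (((hF n).comp (measurable_fst.prodMk ((hp n).comp measurable_snd))) hs)

end CopulaClaims

namespace CopulaClaims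

open Set Filter Topology

/-! ### Distribution functions of atomless laws -/

section AtomlessCDF

variable (μ : Measure ℝ) [IsProbabilityMeasure μ] [NullSingletonClass μ]

theorem continuous_cdf_of_atomless : Continuous (cdf μ) := by
  refine continuous_iff_continuousAt.2 fun x => ?_
  rw [(monotone_cdf μ).continuousAt_iff_leftLim_eq_rightLim, StieltjesFunction.rightLim_eq]
  have h : (cdf μ).measure {x} = 0 := by rw [measure_cdf]; exact measure_singleton x
  rw [StieltjesFunction.measure_singleton, ENNReal.ofReal_eq_zero, sub_nonpos] at h
  exact le_antisymm ((monotone_cdf μ).leftLim_le le_rfl) h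

/-- The level is attained by continuity, and the sublevel set is closed and bounded above. Its
supremum is the right end of the possible flat piece at height `v`. -/
theorem exists_setOf_cdf_le_eq_Iic {v : ℝ} (h0 : 0 < v) (h1 : v < 1) :
    ∃ y, cdf μ y = v ∧ {u | cdf μ u ≤ v} = Iic y := by
  have hc := continuous_cdf_of_atomless μ
  obtain ⟨a, ha⟩ := ((tendsto_cdf_atBot μ).eventually (gt_mem_nhds h0)).exists
  obtain ⟨b, hb⟩ := ((tendsto_cdf_atTop μ).eventually (lt_mem_nhds h1)).exists
  obtain ⟨x, hx⟩ : ∃ x, cdf μ x = v := mem_range_of_exists_le_of_exists_ge hc ⟨a, ha.le⟩ ⟨b, hb.le⟩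
  let S := {u | cdf μ u ≤ v}
  have hxS : x ∈ S := hx.le
  have hbdd : BddAbove S := ⟨b, fun u hu => le_of_not_gt fun h =>
    absurd (hu.trans_lt hb) (not_lt.2 (monotone_cdf μ h.le))⟩
  have hmem : sSup S ∈ S := (isClosed_le hc continuous_const).csSup_mem ⟨x, hxS⟩ hbdd
  refine ⟨sSup S, le_antisymm hmem ?_, ?_⟩
  · exact hx ▸ monotone_cdf μ (le_csSup hbdd hxS)
  · ext u
    exact ⟨fun hu => le_csSup hbdd hu, fun hu => (monotone_cdf μ hu).trans hmem⟩

/-- The probability integral transform: `cdf μ` is uniformly distributed under `μ`. -/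
theorem measure_setOf_cdf_le {v : ℝ} (h0 : 0 ≤ v) (h1 : v ≤ 1) :
    μ {u | cdf μ u ≤ v} = ENNReal.ofReal v := by
  have key : ∀ w : ℝ, 0 < w → w < 1 → μ {u | cdf μ u ≤ w} = ENNReal.ofReal w := by
    intro w hw0 hw1
    obtain ⟨y, hy, hS⟩ := exists_setOf_cdf_le_eq_Iic μ hw0 hw1
    rw [hS, ← ofReal_cdf, hy]
  rcases h1.lt_or_eq with h1 | rfl
  · rcases h0.lt_or_eq with h0 | rfl
    · exact key v h0 h1
    -- At height `0` the sublevel set may be empty, so no endpoint `y` is available; its mass is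
    -- squeezed by the levels `w ↓ 0`.
    · rw [ENNReal.ofReal_zero]
      have hlim : Tendsto (fun w : ℝ => ENNReal.ofReal w) (𝓝[>] 0) (𝓝 0) := by
        simpa using (ENNReal.continuous_ofReal.tendsto (0 : ℝ)).mono_left nhdsWithin_le_nhds
      refine le_antisymm (ge_of_tendsto hlim ?_) zero_le
      filter_upwards [Ioo_mem_nhdsGT (zero_lt_one' ℝ)] with w hw
      rw [← key w hw.1 hw.2]
      exact measure_mono fun u hu => le_trans hu hw.1.le
  · simp [cdf_le_one]

theorem ae_cdf_mem_Ioo : ∀ᵐ u ∂μ, cdf μ u ∈ Ioo (0 : ℝ) 1 := by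
  have h0 : ∀ᵐ u ∂μ, 0 < cdf μ u := by
    have := measure_setOf_cdf_le μ le_rfl zero_le_one
    simpa [ae_iff] using this
  have h1 : ∀ᵐ u ∂μ, cdf μ u < 1 := by
    have hm : MeasurableSet {u | cdf μ u < 1} :=
      measurableSet_lt (monotone_cdf μ).measurable measurable_const
    rw [ae_iff, ← compl_ofPred, prob_compl_eq_zero_iff hm]
    refine le_antisymm prob_le_one ?_
    have hlim : Tendsto (fun w : ℝ => ENNReal.ofReal w) (𝓝[<] 1) (𝓝 1) := by
      simpa using (ENNReal.continuous_ofReal.tendsto (1 : ℝ)).mono_left nhdsWithin_le_nhds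
    refine le_of_tendsto hlim ?_
    filter_upwards [Ioo_mem_nhdsLT (zero_lt_one' ℝ)] with w hw
    rw [← measure_setOf_cdf_le μ hw.1.le hw.2.le]
    exact measure_mono fun u hu => lt_of_le_of_lt hu hw.2
  filter_upwards [h0, h1] with u hu0 hu1 using ⟨hu0, hu1⟩

/-- The two sets differ only on a flat piece of the distribution function: one contains the other
and both have mass `cdf μ y`. -/
theorem ae_le_iff_cdf_le (y : ℝ) : ∀ᵐ u ∂μ, u ≤ y ↔ cdf μ u ≤ cdf μ y := by
  have hsub : Iic y ⊆ {u | cdf μ u ≤ cdf μ y} := fun u hu => monotone_cdf μ hu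
  have h := ae_eq_of_subset_of_measure_ge hsub
    (by rw [measure_setOf_cdf_le μ (cdf_nonneg μ y) (cdf_le_one μ y), ofReal_cdf])
    measurableSet_Iic.nullMeasurableSet (measure_ne_top _ _)
  filter_upwards [h] with u hu
  exact Iff.of_eq hu

end AtomlessCDF

/-! ### The standard normal distribution function and its quantile function -/


instance : NullSingletonClass (gaussianReal 0 1) := nullSingletonClass_gaussianReal one_ne_zero

theorem Phi_coe (x : ℝ) : Phi x = cdf (gaussianReal 0 1) x := by
  simp [Phi, cdf_eq_real, Iic_def]

theorem Phi_nonneg (x : EReal) : 0 ≤ Phi x := measureReal_nonneg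

theorem Phi_le_one (x : EReal) : Phi x ≤ 1 := measureReal_le_one

theorem monotone_Phi : Monotone Phi := fun _ _ h =>
  measureReal_mono fun _ hz => le_trans hz h

theorem continuous_Phi_coe : Continuous fun x : ℝ => Phi x := by
  simp_rw [Phi_coe]
  exact continuous_cdf_of_atomless (gaussianReal 0 1)

theorem measurable_Phi_coe : Measurable fun x : ℝ => Phi x := continuous_Phi_coe.measurable

theorem strictMono_Phi_coe : StrictMono fun x : ℝ => Phi x := by
  intro x y hxy
  simp only [Phi_coe, cdf_eq_real]
  have hpos : 0 < (gaussianReal 0 1).real (Ioc x y) := by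
    refine ENNReal.toReal_pos (fun h => ?_) (measure_ne_top _ _)
    have : volume (Ioc x y) = 0 := gaussianReal_absolutelyContinuous' 0 one_ne_zero h
    simp [hxy.not_ge] at this
  have h := measureReal_union (μ := gaussianReal 0 1) (Iic_disjoint_Ioc le_rfl : Disjoint (Iic x) (Ioc x y))
    measurableSet_Ioc
  rw [Iic_union_Ioc_eq_Iic hxy.le] at h
  linarith

theorem Phi_coe_pos (x : ℝ) : 0 < Phi x :=
  (Phi_nonneg _).trans_lt (strictMono_Phi_coe (sub_one_lt x))

theorem Phi_coe_lt_one (x : ℝ) : Phi x < 1 :=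
  (strictMono_Phi_coe (lt_add_one x)).trans_le (Phi_le_one _)

/-- The Galois connection between the quantile function and the distribution function. -/
theorem coe_le_PhiInv_iff {x u : ℝ} : (x : EReal) ≤ PhiInv u ↔ Phi x ≤ u := by
  constructor
  · intro h
    by_contra! hu
    -- By continuity `Φ` already exceeds `u` at some `z < x`, which bounds the quantile strictly
    -- below `x`.
    obtain ⟨z, hzx, hz⟩ := ((continuous_Phi_coe.continuousAt (x := x)).eventually
      (lt_mem_nhds hu)).filter_mono nhdsWithin_le_nhds |>.and
        (self_mem_nhdsWithin (a := x) (s := Iio x)) |>.exists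
    have h1 : PhiInv u ≤ (z : EReal) := sInf_le ⟨z, hzx.le, rfl⟩
    exact absurd (EReal.coe_le_coe_iff.1 (h.trans h1)) (not_le.2 hz)
  · intro h
    refine le_sInf ?_
    rintro _ ⟨z, hz, rfl⟩
    exact EReal.coe_le_coe_iff.2 (strictMono_Phi_coe.le_iff_le.1 (h.trans hz))

theorem monotone_PhiInv : Monotone PhiInv := fun _ _ h =>
  sInf_le_sInf (image_mono fun _ hz => h.trans hz)

theorem PhiInv_Phi (x : ℝ) : PhiInv (Phi x) = x :=
  le_antisymm (sInf_le ⟨x, le_refl (Phi x), rfl⟩) (coe_le_PhiInv_iff.2 le_rfl)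

theorem exists_Phi_eq {u : ℝ} (hu : u ∈ Ioo (0 : ℝ) 1) : ∃ x : ℝ, Phi x = u := by
  obtain ⟨y, hy, -⟩ := exists_setOf_cdf_le_eq_Iic (gaussianReal 0 1) hu.1 hu.2
  exact ⟨y, (Phi_coe y).trans hy⟩

theorem Phi_toReal_PhiInv {u : ℝ} (hu : u ∈ Ioo (0 : ℝ) 1) : Phi ((PhiInv u).toReal : ℝ) = u := by
  obtain ⟨x, rfl⟩ := exists_Phi_eq hu
  rw [PhiInv_Phi, EReal.toReal_coe]

theorem phi_pos (x : ℝ) : 0 < phi x := gaussianPDFReal_pos 0 1 x one_ne_zero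

/-- A rescaled quantile inside `Φ`, as a probability for a standard normal variable. -/
theorem Phi_PhiInv_sub_div (u m : ℝ) {s : ℝ} (hs : 0 < s) :
    Phi ((PhiInv u - (m : EReal)) / (s : EReal)) = (gaussianReal 0 1).real {e | Phi ((m + s * e : ℝ) : EReal) ≤ u} := by
  unfold Phi
  congr 1
  ext e
  change (e : EReal) ≤ _ ↔ Phi ((m + s * e : ℝ) : EReal) ≤ u
  rw [← coe_le_PhiInv_iff]
  induction PhiInv u with
  | bot =>
    rw [EReal.bot_sub, EReal.bot_div_of_pos_ne_top (by exact_mod_cast hs) (EReal.coe_ne_top _)]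
    simp only [le_bot_iff, EReal.coe_ne_bot]
  | top =>
    rw [EReal.top_sub_coe, EReal.top_div_of_pos_ne_top (by exact_mod_cast hs) (EReal.coe_ne_top _)]
    simp only [le_top]
  | coe q =>
    rw [← EReal.coe_sub, ← EReal.coe_div, EReal.coe_le_coe_iff, EReal.coe_le_coe_iff,
      le_div_iff₀ hs]
    constructor <;> intro h <;> linarith

/-! ### Normal scores of the severities -/

/-- The law with density `g`. -/
noncomputable def sevMeasure (g : ℝ → ℝ) : Measure ℝ := volume.withDensity fun x => ENNReal.ofReal (g x)

theorem IsSeverityDensity.isProbabilityMeasure {g : ℝ → ℝ} (hg : IsSeverityDensity g) :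
    IsProbabilityMeasure (sevMeasure g) :=
  ⟨by rw [sevMeasure, withDensity_apply _ MeasurableSet.univ, Measure.restrict_univ,
    hg.lintegral_eq_one]⟩

instance (g : ℝ → ℝ) : NullSingletonClass (sevMeasure g) :=
  ⟨fun x => withDensity_absolutelyContinuous _ _ (measure_singleton x)⟩

theorem sevCDF_eq (g : ℝ → ℝ) (y : ℝ) : sevCDF g y = cdf (sevMeasure g) y := rfl

theorem measurable_sevCDF (g : ℝ → ℝ) : Measurable (sevCDF g) := (monotone_cdf _).measurable

/-- The normal score of one severity. -/
noncomputable def score (g : ℝ → ℝ) (y : ℝ) : ℝ := (PhiInv (sevCDF g y)).toReal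

theorem measurable_score (g : ℝ → ℝ) : Measurable (score g) :=
  (monotone_PhiInv.measurable.comp (measurable_sevCDF g)).ereal_toReal

/-- `toReal` spoils the quantile only where it is infinite, that is where the distribution function
is `0` or `1`, and this set is null for the law itself. -/
theorem ae_Phi_score {g : ℝ → ℝ} (hg : IsSeverityDensity g) :
    ∀ᵐ u ∂(sevMeasure g), Phi (score g u : ℝ) = sevCDF g u := by
  have := hg.isProbabilityMeasure
  filter_upwards [ae_cdf_mem_Ioo (sevMeasure g)] with u hu using Phi_toReal_PhiInv hu

/-- Almost surely, the score is at most `x` exactly when the distribution function is at most `Φ x`,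
an event of mass `Φ x` by the probability integral transform. Strict monotonicity of `G` is not
needed. -/
theorem map_score {g : ℝ → ℝ} (hg : IsSeverityDensity g) :
    (sevMeasure g).map (score g) = gaussianReal 0 1 := by
  have := hg.isProbabilityMeasure
  have := Measure.isProbabilityMeasure_map (μ := sevMeasure g) (measurable_score g).aemeasurable
  refine Measure.ext_of_Iic _ _ fun x => ?_
  rw [Measure.map_apply (measurable_score g) measurableSet_Iic, ← ofReal_cdf (gaussianReal 0 1), ← Phi_coe,
    ← measure_setOf_cdf_le (sevMeasure g) (Phi_nonneg x) (Phi_le_one x)]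
  refine measure_congr ?_
  filter_upwards [ae_Phi_score hg] with u hu
  refine propext ?_
  change score g u ≤ x ↔ cdf (sevMeasure g) u ≤ Phi x
  rw [← sevCDF_eq, ← hu]
  exact strictMono_Phi_coe.le_iff_le.symm

theorem ae_le_iff_Phi_score_le {g : ℝ → ℝ} (hg : IsSeverityDensity g) (y : ℝ) :
    ∀ᵐ u ∂(sevMeasure g), u ≤ y ↔ Phi (score g u : ℝ) ≤ sevCDF g y := by
  have := hg.isProbabilityMeasure
  filter_upwards [ae_Phi_score hg, ae_le_iff_cdf_le (sevMeasure g) y] with u hu h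
  rw [hu, h, sevCDF_eq, sevCDF_eq]

/-! ### Distribution functions of the frequencies -/

theorem monotone_freqCDF (f : PMF ℕ) : Monotone (freqCDF f) := monotone_cdf _

theorem freqCDF_neg_one (f : PMF ℕ) : freqCDF f (-1) = 0 := by
  have : IsProbabilityMeasure (f.toMeasure.map (fun n : ℕ => (n : ℝ))) :=
    Measure.isProbabilityMeasure_map (by fun_prop)
  rw [freqCDF, cdf_eq_real, measureReal_def, Measure.map_apply (by fun_prop) measurableSet_Iic]
  have : (fun n : ℕ => (n : ℝ)) ⁻¹' Iic (-1) = ∅ := by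
    ext m
    simp only [mem_preimage, mem_Iic, mem_empty_iff_false, iff_false, not_le]
    exact neg_one_lt_zero.trans_le m.cast_nonneg
  simp [this]

theorem tendsto_freqCDF (f : PMF ℕ) : Tendsto (fun n : ℕ => freqCDF f n) atTop (𝓝 1) :=
  (tendsto_cdf_atTop _).comp tendsto_natCast_atTop_atTop

end CopulaClaims

namespace CopulaClaims

open Set Filter Topology Matrix

/-! ### The density of the multivariate normal distribution -/

theorem continuous_mvNormalDensity {n : ℕ} (S : Matrix (Fin n) (Fin n) ℝ) :
    Continuous fun p : (Fin n → ℝ) × (Fin n → ℝ) => mvNormalDensity p.1 S p.2 := by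
  unfold mvNormalDensity
  fun_prop

theorem mvNormalDensity_nonneg {n : ℕ} (m : Fin n → ℝ) (S : Matrix (Fin n) (Fin n) ℝ)
    (x : Fin n → ℝ) : 0 ≤ mvNormalDensity m S x := by
  unfold mvNormalDensity
  positivity

/-- The bound is uniform in the mean, hence in `r`; it later dominates the integrand of the joint
density. -/
theorem mvNormalDensity_le {n : ℕ} (m : Fin n → ℝ) {S : Matrix (Fin n) (Fin n) ℝ} (hS : S.PosDef)
    (x : Fin n → ℝ) : mvNormalDensity m S x ≤ (√((2 * Real.pi) ^ n * S.det))⁻¹ := by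
  unfold mvNormalDensity
  refine mul_le_of_le_one_right (by positivity) (Real.exp_le_one_iff.2 ?_)
  have h := hS.inv.posSemidef.dotProduct_mulVec_nonneg (x - m)
  simp only [star_trivial] at h
  linarith

theorem pi_gaussianReal_eq_withDensity (n : ℕ) :
    Measure.pi (fun _ : Fin n => gaussianReal 0 1) =
      volume.withDensity fun x => ENNReal.ofReal (∏ i, phi (x i)) := by
  have h1 : (gaussianReal 0 1) = volume.withDensity (gaussianPDF 0 1) :=
    gaussianReal_of_var_ne_zero 0 one_ne_zero
  have : SigmaFinite (volume.withDensity (gaussianPDF 0 1)) := by rw [← h1]; infer_instance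
  rw [h1, pi_withDensity_fin _ _ fun _ => measurable_gaussianPDF 0 1]
  congr 1
  ext x
  rw [ENNReal.ofReal_prod_of_nonneg fun i _ => (phi_pos _).le]
  rfl

theorem prod_phi {n : ℕ} (x : Fin n → ℝ) :
    ∏ i, phi (x i) = (√((2 * Real.pi) ^ n))⁻¹ * Real.exp (-(x ⬝ᵥ x) / 2) := by
  simp only [phi, gaussianPDFReal, NNReal.coe_one, mul_one, sub_zero, Finset.prod_mul_distrib,
    Finset.prod_const, Finset.card_univ, Fintype.card_fin, ← Real.exp_sum]
  congr 1
  · rw [inv_pow, Real.sqrt_eq_rpow, Real.sqrt_eq_rpow, ← Real.rpow_natCast, ← Real.rpow_natCast,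
      ← Real.rpow_mul (by positivity), ← Real.rpow_mul (by positivity), mul_comm (n : ℝ)]
  · congr 1
    simp only [dotProduct, ← Finset.sum_div, Finset.sum_neg_distrib, sq]

/-- The centred law is the image of the standard normal law under the symmetric root `L` of `S`. The
substitution `z = L x` has Jacobian `1 / |det L| = 1 / √(det S)`, and `|L⁻¹ z|² = zᵀ S⁻¹ z`. -/
theorem lintegral_multivariateGaussian {n : ℕ} (m : Fin n → ℝ) {S : Matrix (Fin n) (Fin n) ℝ}
    (hS : S.PosDef) {F : (Fin n → ℝ) → ENNReal} (hF : Measurable F) :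
    ∫⁻ w, F (m + w.ofLp) ∂(multivariateGaussian 0 S) =
      ∫⁻ x, ENNReal.ofReal (mvNormalDensity m S x) * F x := by
  open scoped MatrixOrder in
  obtain ⟨L, hLsymm, hLL⟩ : ∃ L : Matrix (Fin n) (Fin n) ℝ, Lᵀ = L ∧ L * L = S ∧
      multivariateGaussian 0 S = (stdGaussian (EuclideanSpace ℝ (Fin n))).map
        (fun x => toEuclideanCLM (𝕜 := ℝ) L x) := by
    refine ⟨CFC.sqrt S, ?_, CFC.sqrt_mul_sqrt_self _ hS.posSemidef.nonneg, ?_⟩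
    · have := (CFC.sqrt_nonneg S).isSelfAdjoint
      rwa [isSelfAdjoint_iff, star_eq_conjTranspose, conjTranspose_eq_transpose_of_trivial] at this
    · simp [multivariateGaussian]
  obtain ⟨hLS, hmG⟩ := hLL
  have hdetS : 0 < S.det := hS.det_pos
  have hdet : L.det * L.det = S.det := by rw [← det_mul, hLS]
  have hdetL : L.det ≠ 0 := fun h => by simp [h] at hdet; exact hdetS.ne hdet
  have hLu : IsUnit L.det := isUnit_iff_ne_zero.2 hdetL
  have hinv : L⁻¹ * L⁻¹ = S⁻¹ := by rw [← hLS, Matrix.mul_inv_rev]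
  have hinvT : (L⁻¹)ᵀ = L⁻¹ := by rw [transpose_nonsing_inv, hLsymm]
  -- The integrand against Lebesgue measure, written as a function of `z = L x`.
  let H : (Fin n → ℝ) → ENNReal := fun z =>
    ENNReal.ofReal (∏ i, phi ((L⁻¹ *ᵥ z) i)) * F (m + z)
  have hphi : Measurable phi := measurable_gaussianPDFReal 0 1
  have hH : Measurable H := by
    refine Measurable.mul (ENNReal.measurable_ofReal.comp (Finset.measurable_prod _ fun i _ => ?_))
      (hF.comp (measurable_const_add m))
    exact hphi.comp (by fun_prop : Continuous fun z : Fin n → ℝ => (L⁻¹ *ᵥ z) i).measurable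
  have hdens : Measurable fun x : Fin n → ℝ => ENNReal.ofReal (∏ i, phi (x i)) :=
    ENNReal.measurable_ofReal.comp (Finset.measurable_prod _ fun i _ =>
      hphi.comp (measurable_pi_apply i))
  have hLc : Measurable fun z : Fin n → ℝ => L *ᵥ z :=
    (by fun_prop : Continuous fun z : Fin n → ℝ => L *ᵥ z).measurable
  have hHm : Measurable fun z : Fin n → ℝ => H (z - m) := hH.comp (measurable_sub_const m)
  have hFL : Measurable fun z : Fin n → ℝ => F (m + L *ᵥ z) := hF.comp (hLc.const_add m)
  calc ∫⁻ w, F (m + w.ofLp) ∂(multivariateGaussian 0 S)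
      = ∫⁻ x, F (m + L *ᵥ x) ∂(Measure.pi fun _ : Fin n => gaussianReal 0 1) := by
        rw [hmG, ← map_pi_eq_stdGaussian, Measure.map_map (by fun_prop) (by fun_prop),
          lintegral_map (by fun_prop) (by fun_prop)]
        simp
    _ = ∫⁻ x, H (L *ᵥ x) := by
        rw [pi_gaussianReal_eq_withDensity, lintegral_withDensity_eq_lintegral_mul _ hdens hFL]
        refine lintegral_congr fun x => ?_
        simp [H, mulVec_mulVec, nonsing_inv_mul _ hLu]
    _ = ENNReal.ofReal |L.det⁻¹| * ∫⁻ z, H z := by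
        have := Real.map_matrix_volume_pi_eq_smul_volume_pi hdetL
        rw [← smul_eq_mul, ← lintegral_smul_measure, ← this, lintegral_map hH
          (show Measurable (toLin' L) from hLc)]
        simp
    _ = ENNReal.ofReal |L.det⁻¹| * ∫⁻ x, H (x - m) := by
        rw [lintegral_sub_right_eq_self]
    _ = ∫⁻ x, ENNReal.ofReal (mvNormalDensity m S x) * F x := by
        rw [← lintegral_const_mul _ hHm]
        refine lintegral_congr fun x => ?_
        simp only [H, add_sub_cancel]
        rw [← mul_assoc, ← ENNReal.ofReal_mul (abs_nonneg _), prod_phi]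
        congr 2
        have hq : (L⁻¹ *ᵥ (x - m)) ⬝ᵥ (L⁻¹ *ᵥ (x - m)) = (x - m) ⬝ᵥ (S⁻¹ *ᵥ (x - m)) := by
          rw [dotProduct_mulVec, ← mulVec_transpose, hinvT, mulVec_mulVec, hinv, dotProduct_comm]
        rw [hq, mvNormalDensity, ← mul_assoc]
        congr 1
        rw [Real.sqrt_mul (by positivity), mul_inv, mul_comm, abs_inv, ← hdet,
          Real.sqrt_mul_self_eq_abs]

/-! ### Normal scores as a change of variables -/

theorem measurable_scores (g : ℝ → ℝ) (n : ℕ) : Measurable (scores g : (Fin n → ℝ) → Fin n → ℝ) :=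
  measurable_pi_lambda _ fun j => (measurable_score g).comp (measurable_pi_apply j)

theorem pi_sevMeasure {g : ℝ → ℝ} (hg : IsSeverityDensity g) (n : ℕ) :
    (Measure.pi fun _ : Fin n => sevMeasure g) =
      volume.withDensity fun y => ∏ i, ENNReal.ofReal (g (y i)) := by
  have := hg.isProbabilityMeasure
  have : SigmaFinite (volume.withDensity fun x => ENNReal.ofReal (g x)) := by
    change SigmaFinite (sevMeasure g); infer_instance
  exact pi_withDensity_fin (fun _ => volume) _ fun _ =>
    ENNReal.measurable_ofReal.comp hg.measurable

theorem measurable_prod_ofReal {g : ℝ → ℝ} (hg : IsSeverityDensity g) (n : ℕ) :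
    Measurable fun y : Fin n → ℝ => ∏ i, ENNReal.ofReal (g (y i)) :=
  Finset.measurable_prod _ fun i _ =>
    ENNReal.measurable_ofReal.comp (hg.measurable.comp (measurable_pi_apply i))

/-- Both sides are integrals of the density ratio of `N(m, S)` to the standard normal law: one
against the standard normal law, the other against the severity law whose image under the scores it
is. No derivative or inverse of the score map enters. -/
theorem lintegral_mvNormalDensity_scores {g : ℝ → ℝ} (hg : IsSeverityDensity g) {n : ℕ}
    (m : Fin n → ℝ) (S : Matrix (Fin n) (Fin n) ℝ) {F : (Fin n → ℝ) → ENNReal} (hF : Measurable F) :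
    ∫⁻ x, ENNReal.ofReal (mvNormalDensity m S x) * F x =
      ∫⁻ y, ENNReal.ofReal (mvNormalDensity m S (scores g y) *
        ∏ j, g (y j) / phi (scores g y j)) * F (scores g y) := by
  have := hg.isProbabilityMeasure
  have hphi : Measurable phi := measurable_gaussianPDFReal 0 1
  have hprod : Measurable fun x : Fin n → ℝ => ∏ i, phi (x i) :=
    Finset.measurable_prod _ fun i _ => hphi.comp (measurable_pi_apply i)
  have hmv : Measurable (mvNormalDensity m S) :=
    ((continuous_mvNormalDensity S).comp (by fun_prop : Continuous fun x => (m, x))).measurable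
  have hprod_pos : ∀ x : Fin n → ℝ, 0 < ∏ i, phi (x i) := fun x =>
    Finset.prod_pos fun i _ => phi_pos _
  have hprod' : Measurable fun x : Fin n → ℝ => ENNReal.ofReal (∏ i, phi (x i)) :=
    ENNReal.measurable_ofReal.comp hprod
  let K : (Fin n → ℝ) → ENNReal := fun x =>
    ENNReal.ofReal (mvNormalDensity m S x / ∏ i, phi (x i)) * F x
  have hK : Measurable K := (ENNReal.measurable_ofReal.comp (hmv.div hprod)).mul hF
  have hmap : (Measure.pi fun _ : Fin n => sevMeasure g).map (scores g) =
      Measure.pi fun _ : Fin n => gaussianReal 0 1 := by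
    have h' : SigmaFinite ((sevMeasure g).map (score g)) := by rw [map_score hg]; infer_instance
    have := Measure.pi_map_pi (μ := fun _ : Fin n => sevMeasure g)
      (f := fun _ => score g) fun _ => (measurable_score g).aemeasurable
    rw [map_score hg] at this
    exact this
  calc ∫⁻ x, ENNReal.ofReal (mvNormalDensity m S x) * F x
      = ∫⁻ x, K x ∂(Measure.pi fun _ : Fin n => gaussianReal 0 1) := by
        rw [pi_gaussianReal_eq_withDensity, lintegral_withDensity_eq_lintegral_mul _
          hprod' hK]
        refine lintegral_congr fun x => ?_
        simp only [K, Pi.mul_apply]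
        rw [← mul_assoc, ← ENNReal.ofReal_mul (hprod_pos x).le, mul_div_cancel₀ _ (hprod_pos x).ne']
    _ = ∫⁻ y, K (scores g y) ∂(Measure.pi fun _ : Fin n => sevMeasure g) := by
        rw [← hmap, lintegral_map hK (measurable_scores g n)]
    _ = _ := by
        have hKs : Measurable fun y : Fin n → ℝ => K (scores g y) := hK.comp (measurable_scores g n)
        rw [pi_sevMeasure hg, lintegral_withDensity_eq_lintegral_mul _
          (measurable_prod_ofReal hg n) hKs]
        refine lintegral_congr fun y => ?_
        simp only [K, Pi.mul_apply]
        rw [← ENNReal.ofReal_prod_of_nonneg fun i _ => hg.nonneg _, ← mul_assoc,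
          ← ENNReal.ofReal_mul (Finset.prod_nonneg fun i _ => hg.nonneg _), Finset.prod_div_distrib]
        congr 2
        ring

theorem lintegral_mvNormalDensity_indicator {g : ℝ → ℝ} (hg : IsSeverityDensity g) {n : ℕ}
    (m : Fin n → ℝ) (S : Matrix (Fin n) (Fin n) ℝ) (y₀ : Fin n → ℝ)
    {F : (Fin n → ℝ) → ENNReal} (hF : Measurable F) :
    ∫⁻ x, ENNReal.ofReal (mvNormalDensity m S x) *
        {x : Fin n → ℝ | ∀ j, Phi (x j) ≤ sevCDF g (y₀ j)}.indicator F x =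
      ∫⁻ y in Iic y₀, ENNReal.ofReal (mvNormalDensity m S (scores g y) *
        ∏ j, g (y j) / phi (scores g y j)) * F (scores g y) := by
  have := hg.isProbabilityMeasure
  set D : Set (Fin n → ℝ) := {x : Fin n → ℝ | ∀ j, Phi (x j) ≤ sevCDF g (y₀ j)} with hD
  have hDm : MeasurableSet D := by
    simp only [hD, ofPred_forall]
    exact MeasurableSet.iInter fun j => measurableSet_le
      (measurable_Phi_coe.comp (measurable_pi_apply j)) measurable_const
  have hae : ∀ᵐ y ∂(Measure.pi fun _ : Fin n => sevMeasure g),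
      ∀ j, y j ≤ y₀ j ↔ Phi (score g (y j) : ℝ) ≤ sevCDF g (y₀ j) := by
    refine ae_all_iff.2 fun j => ?_
    exact (Measure.quasiMeasurePreserving_eval (fun _ : Fin n => sevMeasure g) j).ae
      (ae_le_iff_Phi_score_le hg (y₀ j))
  rw [pi_sevMeasure hg, ae_withDensity_iff (measurable_prod_ofReal hg n)] at hae
  rw [lintegral_mvNormalDensity_scores hg m S (hF.indicator hDm),
    ← lintegral_indicator measurableSet_Iic]
  refine lintegral_congr_ae ?_
  filter_upwards [hae] with y hy
  -- The equivalence `hy` holds only where the product of the `g (y i)` is nonzero; elsewhere both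
  -- integrands vanish.
  by_cases h0 : ∏ i, g (y i) = 0
  · have h1 : ∏ j, g (y j) / phi (scores g y j) = 0 := by
      rw [Finset.prod_div_distrib, h0, zero_div]
    rw [h1, mul_zero, ENNReal.ofReal_zero, zero_mul]
    by_cases hmem : y ∈ Iic y₀
    · rw [indicator_of_mem hmem, h1, mul_zero, ENNReal.ofReal_zero, zero_mul]
    · rw [indicator_of_notMem hmem]
  · have hpos : ∏ i, ENNReal.ofReal (g (y i)) ≠ 0 := by
      rw [← ENNReal.ofReal_prod_of_nonneg fun i _ => hg.nonneg _]
      exact (ENNReal.ofReal_pos.2 ((Finset.prod_nonneg fun i _ => hg.nonneg _).lt_of_ne'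
        h0)).ne'
    have hiff : y ∈ Iic y₀ ↔ scores g y ∈ D := forall_congr' (hy hpos)
    by_cases hmem : y ∈ Iic y₀
    · rw [indicator_of_mem hmem, indicator_of_mem (hiff.1 hmem)]
    · rw [indicator_of_notMem hmem, indicator_of_notMem (fun h => hmem (hiff.2 h)), mul_zero]

end CopulaClaims

namespace CopulaClaims

open Set Filter Topology Matrix

/-! ### Linear algebra of the correlation matrices -/

theorem yearMatrix_mulVec_zero (a b : ℝ) {n : ℕ} (x : Fin (n + 1) → ℝ) :
    (yearMatrix a b n *ᵥ x) 0 = x 0 + a * ∑ j : Fin n, x j.succ := by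
  simp [yearMatrix, mulVec, dotProduct, Fin.sum_univ_succ, Finset.mul_sum, (Fin.succ_ne_zero _).symm]

theorem yearMatrix_mulVec_succ (a b : ℝ) {n : ℕ} (x : Fin (n + 1) → ℝ) (i : Fin n) :
    (yearMatrix a b n *ᵥ x) i.succ = a * x 0 + b * ∑ j : Fin n, x j.succ + (1 - b) * x i.succ := by
  have h : ∀ j : Fin n, (if i = j then x j.succ else b * x j.succ) =
      b * x j.succ + if i = j then (1 - b) * x j.succ else 0 := fun j => by
    split_ifs <;> ring
  simp [yearMatrix, mulVec, dotProduct, Fin.sum_univ_succ, Fin.succ_ne_zero, h, Finset.mul_sum,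
    Finset.sum_add_distrib, add_assoc]

theorem yearMatrix_transpose (a b : ℝ) (n : ℕ) : (yearMatrix a b n)ᵀ = yearMatrix a b n := by
  ext i j
  simp only [yearMatrix, transpose_apply, of_apply, eq_comm (a := j), and_comm (a := j ≠ 0)]

theorem yearMatrix_quadForm (a b : ℝ) {n : ℕ} (x : Fin (n + 1) → ℝ) :
    x ⬝ᵥ (yearMatrix a b n *ᵥ x) = x 0 ^ 2 + 2 * a * x 0 * (∑ j : Fin n, x j.succ) +
      b * (∑ j : Fin n, x j.succ) ^ 2 + (1 - b) * ∑ j : Fin n, x j.succ ^ 2 := by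
  have h : ∀ i : Fin n, x i.succ * (a * x 0 + b * ∑ j : Fin n, x j.succ + (1 - b) * x i.succ) =
      x i.succ * (a * x 0 + b * ∑ j : Fin n, x j.succ) + (1 - b) * x i.succ ^ 2 := fun i => by ring
  simp only [dotProduct, Fin.sum_univ_succ, yearMatrix_mulVec_zero, yearMatrix_mulVec_succ, h,
    Finset.sum_add_distrib, ← Finset.sum_mul, ← Finset.mul_sum]
  ring

section Parameters

variable {ρ : Correlations} {θ : FactorParams}

/-- The conditional covariance matrix of the latent severities of a year given `R`. -/
noncomputable def sevCov (ρ : Correlations) (θ : FactorParams) (n : ℕ) : Matrix (Fin n) (Fin n) ℝ :=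
  (1 - ρ.ρ₂) • (1 : Matrix (Fin n) (Fin n) ℝ) + (ρ.ρ₂ - θ.θ₂ ^ 2) • Matrix.of fun _ _ => (1 : ℝ)

theorem sevCov_mulVec {n : ℕ} (x : Fin n → ℝ) (i : Fin n) :
    (sevCov ρ θ n *ᵥ x) i = (1 - ρ.ρ₂) * x i + (ρ.ρ₂ - θ.θ₂ ^ 2) * ∑ j, x j := by
  rw [sevCov, add_mulVec, smul_mulVec, smul_mulVec, one_mulVec]
  simp [mulVec, dotProduct]

theorem sevCov_quadForm {n : ℕ} (x : Fin n → ℝ) :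
    x ⬝ᵥ (sevCov ρ θ n *ᵥ x) = (1 - ρ.ρ₂) * ∑ j, x j ^ 2 + (ρ.ρ₂ - θ.θ₂ ^ 2) * (∑ j, x j) ^ 2 := by
  have h : ∀ i, x i * ((1 - ρ.ρ₂) * x i + (ρ.ρ₂ - θ.θ₂ ^ 2) * ∑ j, x j) =
      (1 - ρ.ρ₂) * x i ^ 2 + x i * ((ρ.ρ₂ - θ.θ₂ ^ 2) * ∑ j, x j) := fun i => by ring
  simp only [dotProduct, sevCov_mulVec, h, Finset.sum_add_distrib, ← Finset.sum_mul,
    ← Finset.mul_sum]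
  ring

theorem sevCov_posDef (hρ : Reparametrized ρ θ) (h₂₄ : θ.θ₂ ^ 2 + θ.θ₄ ^ 2 < 1) (n : ℕ) :
    (sevCov ρ θ n).PosDef := by
  refine PosDef.of_dotProduct_mulVec_pos ?_ fun x hx => ?_
  · rw [IsHermitian, conjTranspose_eq_transpose_of_trivial]
    ext i j
    simp [sevCov, Matrix.one_apply, eq_comm]
  · rw [star_trivial, sevCov_quadForm, hρ.eq₂]
    obtain ⟨i, hi⟩ := Function.ne_iff.1 hx
    have h1 : 0 < ∑ j, x j ^ 2 := Finset.sum_pos' (fun _ _ => sq_nonneg _)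
      ⟨i, Finset.mem_univ _, by positivity [show x i ≠ 0 from hi]⟩
    have h2 : 0 ≤ θ.θ₄ ^ 2 * (∑ j, x j) ^ 2 := by positivity
    nlinarith

/-- With `s` the sum of the severity coordinates, the quadratic form is `(x₀ + θ₂ s)² + (θ₄ s)² + (1
- ρ₂) ∑ x_j²`, which is positive definite. -/
theorem yearMatrix_det_isUnit (hρ : Reparametrized ρ θ) (h₂₄ : θ.θ₂ ^ 2 + θ.θ₄ ^ 2 < 1) (n : ℕ) :
    IsUnit (yearMatrix θ.θ₂ ρ.ρ₂ n).det := by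
  refine isUnit_iff_ne_zero.2 (PosDef.of_dotProduct_mulVec_pos ?_ fun x hx => ?_).det_pos.ne'
  · rw [IsHermitian, conjTranspose_eq_transpose_of_trivial, yearMatrix_transpose]
  · rw [star_trivial, yearMatrix_quadForm, hρ.eq₂]
    set s := ∑ j : Fin n, x j.succ
    have hQ : 0 ≤ ∑ j : Fin n, x j.succ ^ 2 := Finset.sum_nonneg fun _ _ => sq_nonneg _
    have h4 : 0 ≤ θ.θ₄ ^ 2 * s ^ 2 := by positivity
    rcases hQ.lt_or_eq with hQ | hQ
    · nlinarith [sq_nonneg (x 0 + θ.θ₂ * s)]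
    · have hz : ∀ j : Fin n, x j.succ = 0 := fun j => by
        have := (Finset.sum_eq_zero_iff_of_nonneg fun (j : Fin n) _ => sq_nonneg (x j.succ)).1
          hQ.symm j (Finset.mem_univ _)
        simpa using this
      have hs : s = 0 := Finset.sum_eq_zero fun j _ => hz j
      have h0 : x 0 ≠ 0 := fun h0 => hx (funext fun i => Fin.cases h0 hz i)
      rw [hs, ← hQ]
      have : 0 < x 0 ^ 2 := by positivity
      linarith

/-- The regression coefficients of the latent frequency on `R` and the latent severities. -/
noncomputable def freqWeights (ρ : Correlations) (θ : FactorParams) (n : ℕ) : Fin (n + 1) → ℝ :=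
  (yearMatrix θ.θ₂ ρ.ρ₂ n)⁻¹ *ᵥ freqCov ρ θ n

/-- The conditional mean of the latent frequency given `R` and the latent severities. -/
noncomputable def latentMean (ρ : Correlations) (θ : FactorParams) {n : ℕ} (r : ℝ) (x : Fin n → ℝ) :
    ℝ :=
  freqCov ρ θ n ⬝ᵥ ((yearMatrix θ.θ₂ ρ.ρ₂ n)⁻¹ *ᵥ (Fin.cons r x : Fin (n + 1) → ℝ))

theorem latentMean_eq {n : ℕ} (r : ℝ) (x : Fin n → ℝ) :
    latentMean ρ θ r x = freqWeights ρ θ n 0 * r + ∑ j : Fin n, freqWeights ρ θ n j.succ * x j := by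
  rw [latentMean, dotProduct_mulVec, ← mulVec_transpose, transpose_nonsing_inv,
    yearMatrix_transpose]
  simp [dotProduct, Fin.sum_univ_succ, freqWeights]

/-- The first row of the normal equations. It says that inserting the severity mean `r θ₂` into the
regression gives the frequency mean `r θ₁`. -/
theorem freqWeights_zero (hρ : Reparametrized ρ θ) (h₂₄ : θ.θ₂ ^ 2 + θ.θ₄ ^ 2 < 1) (n : ℕ) :
    freqWeights ρ θ n 0 + θ.θ₂ * ∑ j : Fin n, freqWeights ρ θ n j.succ = θ.θ₁ := by
  rw [← yearMatrix_mulVec_zero θ.θ₂ ρ.ρ₂, freqWeights, mulVec_mulVec,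
    mul_nonsing_inv _ (yearMatrix_det_isUnit hρ h₂₄ n), one_mulVec]
  rfl

/-- The remaining normal equations minus `θ₂` times the first one: the severity weights solve the
regression problem conditional on `R`. -/
theorem sevCov_freqWeights (hρ : Reparametrized ρ θ) (h₂₄ : θ.θ₂ ^ 2 + θ.θ₄ ^ 2 < 1) {n : ℕ}
    (i : Fin n) : (1 - ρ.ρ₂) * freqWeights ρ θ n i.succ +
      (ρ.ρ₂ - θ.θ₂ ^ 2) * ∑ j : Fin n, freqWeights ρ θ n j.succ = ρ.ρ₁ - θ.θ₁ * θ.θ₂ := by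
  have h : (yearMatrix θ.θ₂ ρ.ρ₂ n *ᵥ freqWeights ρ θ n) i.succ = ρ.ρ₁ := by
    rw [freqWeights, mulVec_mulVec, mul_nonsing_inv _ (yearMatrix_det_isUnit hρ h₂₄ n), one_mulVec]
    rfl
  rw [yearMatrix_mulVec_succ] at h
  linear_combination h - θ.θ₂ * freqWeights_zero hρ h₂₄ n

theorem condVar_eq (n : ℕ) : condVar ρ θ n =
    1 - θ.θ₁ * freqWeights ρ θ n 0 - ρ.ρ₁ * ∑ j : Fin n, freqWeights ρ θ n j.succ := by
  change 1 - freqCov ρ θ n ⬝ᵥ freqWeights ρ θ n = _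
  simp [dotProduct, Fin.sum_univ_succ, freqCov, Finset.mul_sum, sub_sub]

/-- Let `w` be the weights, `s` the sum of the severity weights, `a = w₀ + θ₂ s`, `b = θ₄ s`. The
normal equations give `condVar = 1 - 2 w·c + w·A w`, which equals `(a - θ₁)² + (b - θ₃)² + (1 - ρ₂)
∑ w_j² + 1 - θ₁² - θ₃²`. -/
theorem condVar_pos (hρ : Reparametrized ρ θ) (h₁₃ : θ.θ₁ ^ 2 + θ.θ₃ ^ 2 < 1)
    (h₂₄ : θ.θ₂ ^ 2 + θ.θ₄ ^ 2 < 1) (n : ℕ) : 0 < condVar ρ θ n := by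
  have hquad := yearMatrix_quadForm θ.θ₂ ρ.ρ₂ (freqWeights ρ θ n)
  rw [freqWeights, mulVec_mulVec, mul_nonsing_inv _ (yearMatrix_det_isUnit hρ h₂₄ n), one_mulVec,
    ← freqWeights] at hquad
  have hc : freqWeights ρ θ n ⬝ᵥ freqCov ρ θ n = 1 - condVar ρ θ n := by
    rw [dotProduct_comm]
    change _ = 1 - (1 - freqCov ρ θ n ⬝ᵥ freqWeights ρ θ n)
    ring
  have hv := condVar_eq (ρ := ρ) (θ := θ) n
  rw [hc] at hquad
  set w := freqWeights ρ θ n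
  set s := ∑ j : Fin n, w j.succ
  have hQ : 0 ≤ ∑ j : Fin n, w j.succ ^ 2 := Finset.sum_nonneg fun _ _ => sq_nonneg _
  rw [hρ.eq₂] at hquad
  rw [hρ.eq₁] at hv
  nlinarith [sq_nonneg (w 0 + θ.θ₂ * s - θ.θ₁), sq_nonneg (θ.θ₄ * s - θ.θ₃), mul_nonneg (sub_nonneg.2 h₂₄.le) hQ]

/-- The quadratic form of the conditional covariance matrix of a year given `R`. -/
noncomputable def yearForm (ρ : Correlations) (θ : FactorParams) {n : ℕ} (a : ℝ) (v : Fin n → ℝ) : ℝ :=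
  (1 - θ.θ₁ ^ 2) * a ^ 2 + 2 * (ρ.ρ₁ - θ.θ₁ * θ.θ₂) * a * (∑ j, v j) +
    (ρ.ρ₂ - θ.θ₂ ^ 2) * (∑ j, v j) ^ 2 + (1 - ρ.ρ₂) * ∑ j, v j ^ 2

/-- The variance of `a` times the latent frequency plus `v` applied to the latent severities, given
`R`: the regression part of the frequency joins the severity noise with coefficient `a w + v`, and
the independent error contributes `condVar * a²`. -/
theorem yearForm_eq (hρ : Reparametrized ρ θ) (h₂₄ : θ.θ₂ ^ 2 + θ.θ₄ ^ 2 < 1) {n : ℕ}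
    (a : ℝ) (v : Fin n → ℝ) :
    (fun j => a * freqWeights ρ θ n j.succ + v j) ⬝ᵥ
        (sevCov ρ θ n *ᵥ fun j => a * freqWeights ρ θ n j.succ + v j) + condVar ρ θ n * a ^ 2 =
      yearForm ρ θ a v := by
  rw [sevCov_quadForm, yearForm, condVar_eq]
  have h0 := freqWeights_zero hρ h₂₄ n
  have h1 := fun i : Fin n => sevCov_freqWeights hρ h₂₄ i
  generalize freqWeights ρ θ n = w at *
  set s := ∑ j : Fin n, w j.succ with hs
  -- The conditional normal equations paired with a vector `u`; the cases `u = w` and `u = v` remove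
  -- all mixed terms.
  have hlin : ∀ u : Fin n → ℝ, (1 - ρ.ρ₂) * ∑ j, u j * w j.succ + (ρ.ρ₂ - θ.θ₂ ^ 2) * s * ∑ j, u j =
      (ρ.ρ₁ - θ.θ₁ * θ.θ₂) * ∑ j, u j := fun u => by
    simp only [Finset.mul_sum, ← Finset.sum_add_distrib]
    refine Finset.sum_congr rfl fun i _ => ?_
    rw [← h1 i]
    ring
  have e1 : ∑ j : Fin n, (a * w j.succ + v j) ^ 2 =
      a ^ 2 * ∑ j : Fin n, w j.succ * w j.succ + 2 * a * ∑ j : Fin n, v j * w j.succ + ∑ j, v j ^ 2 := by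
    simp only [Finset.mul_sum, ← Finset.sum_add_distrib]
    exact Finset.sum_congr rfl fun i _ => by ring
  have e2 : ∑ j : Fin n, (a * w j.succ + v j) = a * s + ∑ j, v j := by
    rw [hs, Finset.mul_sum, Finset.sum_add_distrib]
  rw [e1, e2]
  have hw := hlin fun j => w j.succ
  have hv := hlin v
  rw [← hs] at hw
  linear_combination a ^ 2 * hw + 2 * a * hv - a ^ 2 * θ.θ₁ * h0

theorem claimMatrix_apply_same {τ : ℕ} (k : Fin τ → ℕ) (t : Fin τ) (l m : Fin (k t + 1)) :
    claimMatrix ρ k ⟨t, l⟩ ⟨t, m⟩ = yearMatrix ρ.ρ₁ ρ.ρ₂ (k t) l m := by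
  simp [claimMatrix]

/-- The correlations of `R` with a frequency or severity. -/
noncomputable def loading (θ : FactorParams) {n : ℕ} (l : Fin (n + 1)) : ℝ := if l = 0 then θ.θ₁ else θ.θ₂

/-- This is where `ρ₃`, `ρ₄`, `ρ₅` must be products of loadings: dependence between years passes
through `R` alone. -/
theorem claimMatrix_apply_ne (hρ : Reparametrized ρ θ) {τ : ℕ} (k : Fin τ → ℕ) {s t : Fin τ}
    (hst : t ≠ s) (l : Fin (k s + 1)) (m : Fin (k t + 1)) :
    claimMatrix ρ k ⟨s, l⟩ ⟨t, m⟩ = loading θ l * loading θ m := by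
  simp only [claimMatrix, of_apply, dif_neg hst, crossMatrix, loading, hρ.eq₃, hρ.eq₄, hρ.eq₅]
  split_ifs <;> simp_all <;> ring

theorem claimMatrix_isSymm (hρ : Reparametrized ρ θ) {τ : ℕ} (k : Fin τ → ℕ) :
    (claimMatrix ρ k)ᵀ = claimMatrix ρ k := by
  ext ⟨s, l⟩ ⟨t, m⟩
  rw [transpose_apply]
  by_cases h : t = s
  · subst h
    rw [claimMatrix_apply_same, claimMatrix_apply_same, ← transpose_apply (yearMatrix _ _ _),
      yearMatrix_transpose]
  · rw [claimMatrix_apply_ne hρ k h, claimMatrix_apply_ne hρ k (Ne.symm h), mul_comm]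

theorem sum_loading_mul {n : ℕ} (x : Fin (n + 1) → ℝ) :
    ∑ l, loading θ l * x l = θ.θ₁ * x 0 + θ.θ₂ * ∑ j : Fin n, x j.succ := by
  simp [loading, Fin.sum_univ_succ, Finset.mul_sum]

/-- The matrix is the rank-one matrix of loadings plus a block diagonal correction, the conditional
covariance of each year given `R`. -/
theorem claimMatrix_mulVec (hρ : Reparametrized ρ θ) {τ : ℕ} (k : Fin τ → ℕ) (u : Position k → ℝ)
    (s : Fin τ) (l : Fin (k s + 1)) :
    (claimMatrix ρ k *ᵥ u) ⟨s, l⟩ = loading θ l * (∑ t, ∑ m, loading θ m * u ⟨t, m⟩) +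
      ((yearMatrix ρ.ρ₁ ρ.ρ₂ (k s) *ᵥ fun m => u ⟨s, m⟩) l -
        loading θ l * ∑ m, loading θ m * u ⟨s, m⟩) := by
  rw [mulVec, dotProduct, Fintype.sum_sigma, ← Finset.add_sum_erase _ _ (Finset.mem_univ s),
    ← Finset.add_sum_erase _ (fun t => ∑ m, loading θ m * u ⟨t, m⟩) (Finset.mem_univ s)]
  have h : ∀ t ∈ Finset.univ.erase s, ∑ m, claimMatrix ρ k ⟨s, l⟩ ⟨t, m⟩ * u ⟨t, m⟩ =
      loading θ l * ∑ m, loading θ m * u ⟨t, m⟩ := fun t ht => by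
    rw [Finset.mul_sum]
    refine Finset.sum_congr rfl fun m _ => ?_
    rw [claimMatrix_apply_ne hρ k (Finset.ne_of_mem_erase ht), mul_assoc]
  rw [Finset.sum_congr rfl h, ← Finset.mul_sum]
  simp only [claimMatrix_apply_same]
  change (yearMatrix ρ.ρ₁ ρ.ρ₂ (k s) *ᵥ fun m => u ⟨s, m⟩) l + _ = _
  ring

/-- The quadratic form of the correlation matrix with random effect. -/
theorem factorMatrix_quadForm (hρ : Reparametrized ρ θ) {τ : ℕ} (k : Fin τ → ℕ)
    (u : Unit ⊕ Position k → ℝ) :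
    u ⬝ᵥ (factorMatrix ρ θ k *ᵥ u) =
      (u (Sum.inl ()) + ∑ t, (θ.θ₁ * u (Sum.inr ⟨t, 0⟩) +
        θ.θ₂ * ∑ j : Fin (k t), u (Sum.inr ⟨t, j.succ⟩))) ^ 2 +
      ∑ t, yearForm ρ θ (u (Sum.inr ⟨t, 0⟩)) (fun j : Fin (k t) => u (Sum.inr ⟨t, j.succ⟩)) := by
  have hload : ∀ {n : ℕ} (l : Fin (n + 1)), (if l = 0 then θ.θ₁ else θ.θ₂) = loading θ l :=
    fun _ => rfl
  have hblock : u ⬝ᵥ (factorMatrix ρ θ k *ᵥ u) =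
      u (Sum.inl ()) ^ 2 + 2 * u (Sum.inl ()) * (∑ t, ∑ l, loading θ l * u (Sum.inr ⟨t, l⟩)) +
        ∑ t, ∑ l, u (Sum.inr ⟨t, l⟩) * (claimMatrix ρ k *ᵥ (u ∘ Sum.inr)) ⟨t, l⟩ := by
    rw [factorMatrix, fromBlocks_mulVec]
    simp only [dotProduct, Fintype.sum_sum_type, Sum.elim_inl, Sum.elim_inr,
      Finset.univ_unique, Finset.sum_singleton, Pi.add_apply, one_mulVec, Function.comp_apply,
      mul_add, Finset.sum_add_distrib, Fintype.sum_sigma]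
    simp only [mulVec, dotProduct, of_apply, transpose_apply, Fintype.sum_sigma, hload,
      Finset.univ_unique, Finset.sum_singleton, Function.comp_apply, PUnit.default_eq_unit]
    have : ∑ t, ∑ l, u (Sum.inr ⟨t, l⟩) * (loading θ l * u (Sum.inl ())) =
        u (Sum.inl ()) * ∑ t, ∑ l, loading θ l * u (Sum.inr ⟨t, l⟩) := by
      simp only [Finset.mul_sum]
      exact Finset.sum_congr rfl fun t _ => Finset.sum_congr rfl fun l _ => by ring
    rw [this]
    ring
  have hyear : ∀ t, ∑ l, u (Sum.inr ⟨t, l⟩) * (claimMatrix ρ k *ᵥ (u ∘ Sum.inr)) ⟨t, l⟩ =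
      (∑ l, loading θ l * u (Sum.inr ⟨t, l⟩)) * (∑ s, ∑ l, loading θ l * u (Sum.inr ⟨s, l⟩)) +
        yearForm ρ θ (u (Sum.inr ⟨t, 0⟩)) (fun j : Fin (k t) => u (Sum.inr ⟨t, j.succ⟩)) := by
    intro t
    have hq := yearMatrix_quadForm ρ.ρ₁ ρ.ρ₂ fun l : Fin (k t + 1) => u (Sum.inr ⟨t, l⟩)
    have hl := sum_loading_mul (θ := θ) fun l : Fin (k t + 1) => u (Sum.inr ⟨t, l⟩)
    simp only [claimMatrix_mulVec hρ, Function.comp_apply, mul_add, mul_sub,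
      Finset.sum_add_distrib, Finset.sum_sub_distrib]
    rw [dotProduct] at hq
    rw [hq, yearForm]
    have h2 : ∀ c : ℝ, ∑ l : Fin (k t + 1), u (Sum.inr ⟨t, l⟩) * (loading θ l * c) =
        (∑ l : Fin (k t + 1), loading θ l * u (Sum.inr ⟨t, l⟩)) * c := fun c => by
      rw [Finset.sum_mul]
      exact Finset.sum_congr rfl fun l _ => by ring
    rw [h2, h2, hl]
    ring
  rw [hblock, Finset.sum_congr rfl fun t _ => hyear t, Finset.sum_add_distrib, ← Finset.sum_mul]
  simp only [sum_loading_mul]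
  ring

theorem factorMatrix_posSemidef (hρ : Reparametrized ρ θ) (h₁₃ : θ.θ₁ ^ 2 + θ.θ₃ ^ 2 < 1)
    (h₂₄ : θ.θ₂ ^ 2 + θ.θ₄ ^ 2 < 1) {τ : ℕ} (k : Fin τ → ℕ) :
    (factorMatrix ρ θ k).PosSemidef := by
  refine PosSemidef.of_dotProduct_mulVec_nonneg ?_ fun u => ?_
  · rw [IsHermitian, conjTranspose_eq_transpose_of_trivial, factorMatrix, fromBlocks_transpose,
      transpose_one, transpose_transpose, claimMatrix_isSymm hρ]
  · rw [star_trivial, factorMatrix_quadForm hρ]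
    refine add_nonneg (sq_nonneg _) (Finset.sum_nonneg fun t _ => ?_)
    rw [← yearForm_eq hρ h₂₄]
    have h := (sevCov_posDef hρ h₂₄ (k t)).posSemidef.dotProduct_mulVec_nonneg
      fun j => u (Sum.inr ⟨t, 0⟩) * freqWeights ρ θ (k t) j.succ + u (Sum.inr ⟨t, j.succ⟩)
    rw [star_trivial] at h
    exact add_nonneg h (mul_nonneg (condVar_pos hρ h₁₃ h₂₄ _).le (sq_nonneg _))

end Parameters

end CopulaClaims

namespace CopulaClaims

open Set Filter Topology Matrix
open scoped RealInnerProductSpace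

/-! ### The one-factor representation of the Gaussian law -/

section Representation

variable {ρ : Correlations} {θ : FactorParams}

/-- The noise of one year: that of the latent severities and that of the latent frequency. -/
noncomputable def yearNoise (ρ : Correlations) (θ : FactorParams) (n : ℕ) :
    Measure (EuclideanSpace ℝ (Fin n) × ℝ) :=
  (multivariateGaussian 0 (sevCov ρ θ n)).prod (gaussianReal 0 1)

instance (n : ℕ) : IsProbabilityMeasure (yearNoise ρ θ n) := by
  unfold yearNoise; infer_instance

/-- The latent severities of a year, given `R = r`. -/
def latentSev (θ : FactorParams) {n : ℕ} (r : ℝ) (w : EuclideanSpace ℝ (Fin n)) : Fin n → ℝ :=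
  (fun _ => r * θ.θ₂) + w.ofLp

/-- The latent variables of a year, given `R = r`. -/
noncomputable def latentYear (ρ : Correlations) (θ : FactorParams) {n : ℕ} (r : ℝ)
    (b : EuclideanSpace ℝ (Fin n) × ℝ) : Fin (n + 1) → ℝ :=
  Fin.cons (latentMean ρ θ r (latentSev θ r b.1) + √(condVar ρ θ n) * b.2) (latentSev θ r b.1)

/-- All the noise. -/
noncomputable def noise (ρ : Correlations) (θ : FactorParams) {τ : ℕ} (k : Fin τ → ℕ) :
    Measure (ℝ × ((t : Fin τ) → EuclideanSpace ℝ (Fin (k t)) × ℝ)) :=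
  (gaussianReal 0 1).prod (Measure.pi fun t => yearNoise ρ θ (k t))

/-- The random effect and all the latent variables. -/
noncomputable def latent (ρ : Correlations) (θ : FactorParams) {τ : ℕ} (k : Fin τ → ℕ)
    (b : ℝ × ((t : Fin τ) → EuclideanSpace ℝ (Fin (k t)) × ℝ)) :
    EuclideanSpace ℝ (Unit ⊕ Position k) :=
  WithLp.toLp 2 (Sum.elim (fun _ => b.1) fun p => latentYear ρ θ b.1 (b.2 p.1) p.2)

theorem continuous_latentMean {n : ℕ} :
    Continuous fun p : ℝ × (Fin n → ℝ) => latentMean ρ θ p.1 p.2 := by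
  simp only [latentMean_eq]
  fun_prop

theorem continuous_latentSev {n : ℕ} :
    Continuous fun p : ℝ × EuclideanSpace ℝ (Fin n) => latentSev θ p.1 p.2 := by
  unfold latentSev
  fun_prop

theorem continuous_latentYear {n : ℕ} :
    Continuous fun p : ℝ × (EuclideanSpace ℝ (Fin n) × ℝ) => latentYear ρ θ p.1 p.2 := by
  have h1 : Continuous fun p : ℝ × (EuclideanSpace ℝ (Fin n) × ℝ) => latentSev θ p.1 p.2.1 :=
    continuous_latentSev.comp (by fun_prop : Continuous
      fun p : ℝ × (EuclideanSpace ℝ (Fin n) × ℝ) => (p.1, p.2.1))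
  have h2 : Continuous fun p : ℝ × (EuclideanSpace ℝ (Fin n) × ℝ) =>
      latentMean ρ θ p.1 (latentSev θ p.1 p.2.1) :=
    continuous_latentMean.comp (continuous_fst.prodMk h1)
  refine continuous_pi fun i => ?_
  refine Fin.cases ?_ (fun j => ?_) i
  · simp only [latentYear, Fin.cons_zero]
    fun_prop
  · simp only [latentYear, Fin.cons_succ]
    exact (continuous_apply j).comp h1

theorem measurable_latent {τ : ℕ} (k : Fin τ → ℕ) : Measurable (latent ρ θ k) := by
  refine (by fun_prop : Measurable (WithLp.toLp 2 : (Unit ⊕ Position k → ℝ) → _)).comp ?_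
  refine measurable_pi_lambda _ fun i => ?_
  rcases i with i | p
  · exact measurable_fst
  · have h1 : Measurable fun b : ℝ × ((t : Fin τ) → EuclideanSpace ℝ (Fin (k t)) × ℝ) => b.2 p.1 :=
      (measurable_pi_apply p.1).comp measurable_snd
    have h2 := (continuous_latentYear (ρ := ρ) (θ := θ) (n := k p.1)).measurable
    have h3 := (measurable_pi_apply p.2).comp (h2.comp (measurable_fst.prodMk h1))
    exact h3

/-- Collecting the coefficients of each independent noise makes the characteristic function a
product. The coefficient of `R` simplifies by `freqWeights_zero`. -/
theorem inner_latent (hρ : Reparametrized ρ θ) (h₂₄ : θ.θ₂ ^ 2 + θ.θ₄ ^ 2 < 1) {τ : ℕ}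
    (k : Fin τ → ℕ) (b : ℝ × ((t : Fin τ) → EuclideanSpace ℝ (Fin (k t)) × ℝ))
    (u : EuclideanSpace ℝ (Unit ⊕ Position k)) :
    ⟪latent ρ θ k b, u⟫ =
      b.1 * (u (Sum.inl ()) + ∑ t, (θ.θ₁ * u (Sum.inr ⟨t, 0⟩) +
        θ.θ₂ * ∑ j : Fin (k t), u (Sum.inr ⟨t, j.succ⟩))) +
      ∑ t, (⟪(b.2 t).1, WithLp.toLp 2 fun j : Fin (k t) =>
          u (Sum.inr ⟨t, 0⟩) * freqWeights ρ θ (k t) j.succ + u (Sum.inr ⟨t, j.succ⟩)⟫ +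
        (b.2 t).2 * (√(condVar ρ θ (k t)) * u (Sum.inr ⟨t, 0⟩))) := by
  have hyear : ∀ t, ∑ l, u (Sum.inr ⟨t, l⟩) * latentYear ρ θ b.1 (b.2 t) l =
      b.1 * (θ.θ₁ * u (Sum.inr ⟨t, 0⟩) + θ.θ₂ * ∑ j : Fin (k t), u (Sum.inr ⟨t, j.succ⟩)) +
      ((∑ j : Fin (k t), (u (Sum.inr ⟨t, 0⟩) * freqWeights ρ θ (k t) j.succ +
          u (Sum.inr ⟨t, j.succ⟩)) * (b.2 t).1 j) +
        (b.2 t).2 * (√(condVar ρ θ (k t)) * u (Sum.inr ⟨t, 0⟩))) := by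
    intro t
    rw [← freqWeights_zero hρ h₂₄ (k t)]
    have e1 : ∀ v : Fin (k t) → ℝ, ∑ j, v j * (b.1 * θ.θ₂ + (b.2 t).1 j) =
        b.1 * θ.θ₂ * ∑ j, v j + ∑ j, v j * (b.2 t).1 j := fun v => by
      rw [Finset.mul_sum, ← Finset.sum_add_distrib]
      exact Finset.sum_congr rfl fun j _ => by ring
    have e2 : ∑ j : Fin (k t), (u (Sum.inr ⟨t, 0⟩) * freqWeights ρ θ (k t) j.succ +
        u (Sum.inr ⟨t, j.succ⟩)) * (b.2 t).1 j =
        u (Sum.inr ⟨t, 0⟩) * (∑ j : Fin (k t), freqWeights ρ θ (k t) j.succ * (b.2 t).1 j) +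
          ∑ j : Fin (k t), u (Sum.inr ⟨t, j.succ⟩) * (b.2 t).1 j := by
      rw [Finset.mul_sum, ← Finset.sum_add_distrib]
      exact Finset.sum_congr rfl fun j _ => by ring
    simp only [Fin.sum_univ_succ, latentYear, Fin.cons_zero, Fin.cons_succ, latentMean_eq, latentSev,
      Pi.add_apply]
    rw [e1, e1, e2]
    ring
  have hsum : ⟪latent ρ θ k b, u⟫ =
      b.1 * u (Sum.inl ()) + ∑ t, ∑ l, u (Sum.inr ⟨t, l⟩) * latentYear ρ θ b.1 (b.2 t) l := by
    simp only [PiLp.inner_apply, latent, RCLike.inner_apply, conj_trivial, Fintype.sum_sum_type,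
      Fintype.sum_sigma, Sum.elim_inl, Sum.elim_inr, Finset.univ_unique, Finset.sum_singleton,
      PUnit.default_eq_unit, mul_comm b.1]
  have hinner : ∀ t, ⟪(b.2 t).1, WithLp.toLp 2 fun j : Fin (k t) =>
      u (Sum.inr ⟨t, 0⟩) * freqWeights ρ θ (k t) j.succ + u (Sum.inr ⟨t, j.succ⟩)⟫ =
      ∑ j : Fin (k t), (u (Sum.inr ⟨t, 0⟩) * freqWeights ρ θ (k t) j.succ +
        u (Sum.inr ⟨t, j.succ⟩)) * (b.2 t).1 j := fun t => by
    simp only [PiLp.inner_apply, RCLike.inner_apply, conj_trivial]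
  rw [hsum, Finset.sum_congr rfl fun t _ => hyear t, Finset.sum_add_distrib, ← Finset.mul_sum,
    ← add_assoc, ← mul_add]
  simp only [hinner]

/-- The noises are independent and Gaussian, so the characteristic function is the exponential of
minus half the sum of their variances, and that sum is the quadratic form of the matrix. -/
theorem map_latent_noise (hρ : Reparametrized ρ θ) (h₁₃ : θ.θ₁ ^ 2 + θ.θ₃ ^ 2 < 1)
    (h₂₄ : θ.θ₂ ^ 2 + θ.θ₄ ^ 2 < 1) {τ : ℕ} (k : Fin τ → ℕ) :
    (noise ρ θ k).map (latent ρ θ k) = multivariateGaussian 0 (factorMatrix ρ θ k) := by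
  have : IsProbabilityMeasure (noise ρ θ k) := by unfold noise; infer_instance
  have := Measure.isProbabilityMeasure_map (μ := noise ρ θ k)
    (measurable_latent (ρ := ρ) (θ := θ) k).aemeasurable
  refine Measure.ext_of_charFun (funext fun u => ?_)
  rw [charFun_multivariateGaussian (factorMatrix_posSemidef hρ h₁₃ h₂₄ k), charFun_apply,
    integral_map (measurable_latent k).aemeasurable (by fun_prop), factorMatrix_quadForm hρ]
  set α : ℝ := u (Sum.inl ()) + ∑ t, (θ.θ₁ * u (Sum.inr ⟨t, 0⟩) +
        θ.θ₂ * ∑ j : Fin (k t), u (Sum.inr ⟨t, j.succ⟩)) with hα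
  set β : (t : Fin τ) → EuclideanSpace ℝ (Fin (k t)) := fun t => WithLp.toLp 2 fun j : Fin (k t) =>
          u (Sum.inr ⟨t, 0⟩) * freqWeights ρ θ (k t) j.succ + u (Sum.inr ⟨t, j.succ⟩) with hβ
  set c : Fin τ → ℝ := fun t => √(condVar ρ θ (k t)) * u (Sum.inr ⟨t, 0⟩) with hc
  have hexp : ∀ b, Complex.exp (⟪latent ρ θ k b, u⟫ * Complex.I) =
      Complex.exp (α * b.1 * Complex.I) *
        ∏ t, (Complex.exp (⟪(b.2 t).1, β t⟫ * Complex.I) *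
          Complex.exp (c t * (b.2 t).2 * Complex.I)) := by
    intro b
    rw [inner_latent hρ h₂₄]
    simp only [← Complex.exp_add, ← Complex.exp_sum]
    congr 1
    push_cast
    rw [add_mul, Finset.sum_mul]
    congr 1
    · rw [hα]; push_cast; ring
    · refine Finset.sum_congr rfl fun t _ => ?_
      simp only [hβ, hc]; push_cast; ring
  have hyear : ∀ t, ∫ p : EuclideanSpace ℝ (Fin (k t)) × ℝ,
      Complex.exp (⟪p.1, β t⟫ * Complex.I) * Complex.exp (c t * p.2 * Complex.I)
        ∂(yearNoise ρ θ (k t)) =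
      Complex.exp (-(yearForm ρ θ (u (Sum.inr ⟨t, 0⟩))
        (fun j : Fin (k t) => u (Sum.inr ⟨t, j.succ⟩)) : ℝ) / 2) := by
    intro t
    rw [yearNoise, integral_prod_mul (fun w => Complex.exp (⟪w, β t⟫ * Complex.I))
      (fun e : ℝ => Complex.exp (c t * e * Complex.I)), ← charFun_apply, ← charFun_apply_real,
      charFun_multivariateGaussian (sevCov_posDef hρ h₂₄ _).posSemidef, charFun_gaussianReal,
      ← Complex.exp_add, ← yearForm_eq hρ h₂₄]
    congr 1
    have hs : (c t) ^ 2 = condVar ρ θ (k t) * u (Sum.inr ⟨t, 0⟩) ^ 2 := by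
      rw [hc, mul_pow, Real.sq_sqrt (condVar_pos hρ h₁₃ h₂₄ _).le]
    rw [← hs]
    simp only [inner_zero_right, hβ]
    push_cast
    ring
  simp_rw [hexp]
  rw [noise, integral_prod_mul (fun r : ℝ => Complex.exp (α * r * Complex.I))
    (fun x : (t : Fin τ) → EuclideanSpace ℝ (Fin (k t)) × ℝ =>
      ∏ t, (Complex.exp (⟪(x t).1, β t⟫ * Complex.I) * Complex.exp (c t * (x t).2 * Complex.I))),
    integral_fintype_prod_eq_prod (fun t (p : EuclideanSpace ℝ (Fin (k t)) × ℝ) =>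
      Complex.exp (⟪p.1, β t⟫ * Complex.I) * Complex.exp (c t * p.2 * Complex.I))]
  simp_rw [hyear]
  rw [← charFun_apply_real, charFun_gaussianReal, ← Complex.exp_sum, ← Complex.exp_add]
  congr 1
  simp only [inner_zero_right]
  push_cast
  rw [← Finset.sum_div, Finset.sum_neg_distrib]
  ring

/-- The Gaussian law of the latent frequencies and severities is a marginal of the law including
the random effect. -/
theorem map_inr_multivariateGaussian (hρ : Reparametrized ρ θ) (h₁₃ : θ.θ₁ ^ 2 + θ.θ₃ ^ 2 < 1)
    (h₂₄ : θ.θ₂ ^ 2 + θ.θ₄ ^ 2 < 1) {τ : ℕ} (k : Fin τ → ℕ) :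
    (multivariateGaussian 0 (factorMatrix ρ θ k)).map (fun x => WithLp.toLp 2 fun p => x (Sum.inr p)) =
      multivariateGaussian 0 (claimMatrix ρ k) := by
  have hm : Measurable (fun x : EuclideanSpace ℝ (Unit ⊕ Position k) =>
    (WithLp.toLp 2 fun p => x (Sum.inr p) : EuclideanSpace ℝ (Position k))) := by fun_prop
  have hF := factorMatrix_posSemidef hρ h₁₃ h₂₄ k
  have hC : (claimMatrix ρ k).PosSemidef := hF.submatrix Sum.inr
  have := Measure.isProbabilityMeasure_map (μ := multivariateGaussian 0 (factorMatrix ρ θ k))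
    hm.aemeasurable
  refine Measure.ext_of_charFun (funext fun u => ?_)
  -- Dropping the coordinate of `R` amounts to testing the characteristic function at vectors with
  -- entry zero there.
  have hinner : ∀ x : EuclideanSpace ℝ (Unit ⊕ Position k),
      ⟪(WithLp.toLp 2 fun p => x (Sum.inr p) : EuclideanSpace ℝ (Position k)), u⟫ =
        ⟪x, WithLp.toLp 2 (Sum.elim 0 u.ofLp)⟫ := fun x => by
    simp [PiLp.inner_apply]
  rw [charFun_apply, integral_map hm.aemeasurable (by fun_prop)]
  simp_rw [hinner]
  rw [← charFun_apply, charFun_multivariateGaussian hF, charFun_multivariateGaussian hC]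
  congr 2
  · simp
  · congr 2
    rw [factorMatrix, fromBlocks_mulVec]
    simp [dotProduct]

end Representation

end CopulaClaims

namespace CopulaClaims

open Set Filter Topology Matrix

/-! ### Conditional law of the claims of a year -/

section Year

variable {ρ : Correlations} {θ : FactorParams}

/-- The conditional distribution function of the latent frequency, at the level `u`. -/
noncomputable def latentFreqCDF (ρ : Correlations) (θ : FactorParams) (n : ℕ) (u m : ℝ) : ℝ :=
  Phi ((PhiInv u - (m : EReal)) / (√(condVar ρ θ n) : EReal))

/-- The conditional probability of `i` claims in a year given `R` and `n` severities. -/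
noncomputable def freqProb (ρ : Correlations) (θ : FactorParams) (f : PMF ℕ) (g : ℝ → ℝ) {n : ℕ}
    (i : ℕ) (r : ℝ) (y : Fin n → ℝ) : ℝ :=
  latentFreqCDF ρ θ n (freqCDF f i) (condMean ρ θ g r y) -
    latentFreqCDF ρ θ n (freqCDF f (i - 1)) (condMean ρ θ g r y)

theorem latentFreqCDF_eq (hρ : Reparametrized ρ θ) (h₁₃ : θ.θ₁ ^ 2 + θ.θ₃ ^ 2 < 1)
    (h₂₄ : θ.θ₂ ^ 2 + θ.θ₄ ^ 2 < 1) (n : ℕ) (u m : ℝ) :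
    latentFreqCDF ρ θ n u m =
      (gaussianReal 0 1).real {e | Phi ((m + √(condVar ρ θ n) * e : ℝ) : EReal) ≤ u} :=
  Phi_PhiInv_sub_div u m (Real.sqrt_pos.2 (condVar_pos hρ h₁₃ h₂₄ n))

theorem latentFreqCDF_mono (hρ : Reparametrized ρ θ) (h₁₃ : θ.θ₁ ^ 2 + θ.θ₃ ^ 2 < 1)
    (h₂₄ : θ.θ₂ ^ 2 + θ.θ₄ ^ 2 < 1) (n : ℕ) {u v : ℝ} (huv : u ≤ v) (m : ℝ) :
    latentFreqCDF ρ θ n u m ≤ latentFreqCDF ρ θ n v m := by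
  rw [latentFreqCDF_eq hρ h₁₃ h₂₄, latentFreqCDF_eq hρ h₁₃ h₂₄]
  exact measureReal_mono fun e he => le_trans he huv

/-- Monotonicity in the mean gives measurability even when the quantile is infinite. -/
theorem measurable_latentFreqCDF (hρ : Reparametrized ρ θ) (h₁₃ : θ.θ₁ ^ 2 + θ.θ₃ ^ 2 < 1)
    (h₂₄ : θ.θ₂ ^ 2 + θ.θ₄ ^ 2 < 1) (n : ℕ) (u : ℝ) : Measurable (latentFreqCDF ρ θ n u) := by
  refine Antitone.measurable fun m m' hm => ?_
  rw [latentFreqCDF_eq hρ h₁₃ h₂₄, latentFreqCDF_eq hρ h₁₃ h₂₄]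
  refine measureReal_mono fun e he => le_trans (monotone_Phi ?_) he
  exact EReal.coe_le_coe_iff.2 (by linarith)

theorem latentFreqCDF_zero (hρ : Reparametrized ρ θ) (h₁₃ : θ.θ₁ ^ 2 + θ.θ₃ ^ 2 < 1)
    (h₂₄ : θ.θ₂ ^ 2 + θ.θ₄ ^ 2 < 1) (n : ℕ) (m : ℝ) : latentFreqCDF ρ θ n 0 m = 0 := by
  rw [latentFreqCDF_eq hρ h₁₃ h₂₄]
  simp only [not_le.2 (Phi_coe_pos _), ofPred_false, measureReal_empty]

theorem freqProb_nonneg (hρ : Reparametrized ρ θ) (h₁₃ : θ.θ₁ ^ 2 + θ.θ₃ ^ 2 < 1)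
    (h₂₄ : θ.θ₂ ^ 2 + θ.θ₄ ^ 2 < 1) (f : PMF ℕ) (g : ℝ → ℝ) {n : ℕ} (i : ℕ) (r : ℝ)
    (y : Fin n → ℝ) : 0 ≤ freqProb ρ θ f g i r y :=
  sub_nonneg.2 (latentFreqCDF_mono hρ h₁₃ h₂₄ n (monotone_freqCDF f (by linarith)) _)

theorem freqProb_le_one (f : PMF ℕ) (g : ℝ → ℝ) {n : ℕ} (i : ℕ) (r : ℝ)
    (y : Fin n → ℝ) : freqProb ρ θ f g i r y ≤ 1 :=
  (sub_le_self _ (Phi_nonneg _)).trans (Phi_le_one _)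

/-- The sum telescopes, starting from `F(-1) = 0`; the subtraction `i - 1` is real, so nothing is
truncated at `i = 0`. -/
theorem sum_freqProb (hρ : Reparametrized ρ θ) (h₁₃ : θ.θ₁ ^ 2 + θ.θ₃ ^ 2 < 1)
    (h₂₄ : θ.θ₂ ^ 2 + θ.θ₄ ^ 2 < 1) (f : PMF ℕ) (g : ℝ → ℝ) {n : ℕ} (m : ℕ) (r : ℝ)
    (y : Fin n → ℝ) : ∑ i ∈ Finset.range (m + 1), freqProb ρ θ f g i r y =
      latentFreqCDF ρ θ n (freqCDF f m) (condMean ρ θ g r y) := by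
  induction m with
  | zero =>
    simp [freqProb, freqCDF_neg_one, latentFreqCDF_zero hρ h₁₃ h₂₄]
  | succ m ih =>
    rw [Finset.sum_range_succ, ih, freqProb]
    simp

theorem lintegral_Iic_freqProb (hρ : Reparametrized ρ θ) (h₁₃ : θ.θ₁ ^ 2 + θ.θ₃ ^ 2 < 1)
    (h₂₄ : θ.θ₂ ^ 2 + θ.θ₄ ^ 2 < 1) (f : PMF ℕ) (g : ℝ → ℝ) {n : ℕ} (m : ℕ) (r : ℝ)
    (y : Fin n → ℝ) : ∫⁻ i in Iic m, ENNReal.ofReal (freqProb ρ θ f g i r y) ∂Measure.count =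
      ENNReal.ofReal (latentFreqCDF ρ θ n (freqCDF f m) (condMean ρ θ g r y)) := by
  rw [← sum_freqProb hρ h₁₃ h₂₄, ENNReal.ofReal_sum_of_nonneg fun i _ =>
    freqProb_nonneg hρ h₁₃ h₂₄ f g i r y, ← lintegral_indicator measurableSet_Iic, lintegral_count,
    tsum_eq_sum (s := Finset.range (m + 1))]
  · refine Finset.sum_congr rfl fun i hi => ?_
    rw [indicator_of_mem]
    exact Nat.lt_succ_iff.1 (Finset.mem_range.1 hi)
  · intro i hi
    rw [indicator_of_notMem]
    simpa [Nat.lt_succ_iff] using hi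

theorem tsum_freqProb (hρ : Reparametrized ρ θ) (h₁₃ : θ.θ₁ ^ 2 + θ.θ₃ ^ 2 < 1)
    (h₂₄ : θ.θ₂ ^ 2 + θ.θ₄ ^ 2 < 1) (f : PMF ℕ) (g : ℝ → ℝ) {n : ℕ} (r : ℝ)
    (y : Fin n → ℝ) : ∑' i, ENNReal.ofReal (freqProb ρ θ f g i r y) = 1 := by
  have h1 := (ENNReal.tendsto_nat_tsum fun i => ENNReal.ofReal (freqProb ρ θ f g i r y)).comp
    (tendsto_add_atTop_nat 1)
  refine tendsto_nhds_unique h1 ?_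
  set m := condMean ρ θ g r y
  set s := √(condVar ρ θ n)
  have h2 : ∀ k : ℕ, ∑ i ∈ Finset.range (k + 1), ENNReal.ofReal (freqProb ρ θ f g i r y) =
      gaussianReal 0 1 {e | Phi ((m + s * e : ℝ) : EReal) ≤ freqCDF f k} := fun k => by
    rw [← ENNReal.ofReal_sum_of_nonneg fun i _ => freqProb_nonneg hρ h₁₃ h₂₄ f g i r y,
      sum_freqProb hρ h₁₃ h₂₄, latentFreqCDF_eq hρ h₁₃ h₂₄, ofReal_measureReal]
  -- `Φ` is strictly below `1` at real points while `F(k) → 1`, so every value of the error is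
  -- eventually covered.
  have hU : ⋃ k : ℕ, {e : ℝ | Phi ((m + s * e : ℝ) : EReal) ≤ freqCDF f k} = univ := by
    refine eq_univ_of_forall fun e => mem_iUnion.2 ?_
    obtain ⟨k, hk⟩ := ((tendsto_freqCDF f).eventually
      (lt_mem_nhds (Phi_coe_lt_one (m + s * e)))).exists
    exact ⟨k, hk.le⟩
  have h3 := tendsto_measure_iUnion_atTop (μ := gaussianReal 0 1)
    (s := fun k : ℕ => {e : ℝ | Phi ((m + s * e : ℝ) : EReal) ≤ freqCDF f k})
    fun a b hab e he => le_trans he (monotone_freqCDF f (Nat.cast_le.2 hab))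
  rw [hU, measure_univ] at h3
  exact h3.congr fun k => (h2 k).symm

theorem continuous_sevDensity_mean {n : ℕ} (S : Matrix (Fin n) (Fin n) ℝ) (c : ℝ) :
    Continuous fun p : ℝ × (Fin n → ℝ) => mvNormalDensity (fun _ => p.1 * c) S p.2 :=
  (continuous_mvNormalDensity S).comp (by fun_prop : Continuous
    fun p : ℝ × (Fin n → ℝ) => ((fun _ => p.1 * c : Fin n → ℝ), p.2))

theorem measurable_condSevDensity {g : ℝ → ℝ} (hg : IsSeverityDensity g) (n : ℕ) :
    Measurable fun p : ℝ × (Fin n → ℝ) => condSevDensity ρ θ g p.1 p.2 := by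
  have hs : Measurable fun p : ℝ × (Fin n → ℝ) => scores g p.2 :=
    (measurable_scores g n).comp measurable_snd
  have h1 := (continuous_sevDensity_mean (n := n) (sevCov ρ θ n) θ.θ₂).measurable.comp
    ((measurable_fst (α := ℝ) (β := Fin n → ℝ)).prodMk hs)
  have h2 : ∀ j, Measurable fun p : ℝ × (Fin n → ℝ) => g (p.2 j) / phi (scores g p.2 j) := fun j => by
    have e1 : Measurable fun p : ℝ × (Fin n → ℝ) => p.2 j := by fun_prop
    have e2 : Measurable fun p : ℝ × (Fin n → ℝ) => scores g p.2 j :=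
      (measurable_score g).comp e1
    exact (hg.measurable.comp e1).div ((measurable_gaussianPDFReal 0 1).comp e2)
  exact h1.mul (Finset.measurable_prod Finset.univ fun j _ => h2 j)

theorem condSevDensity_nonneg {g : ℝ → ℝ} (hg : IsSeverityDensity g) {n : ℕ} (r : ℝ)
    (y : Fin n → ℝ) : 0 ≤ condSevDensity ρ θ g r y :=
  mul_nonneg (mvNormalDensity_nonneg _ _ _)
    (Finset.prod_nonneg fun _ _ => div_nonneg (hg.nonneg _) (phi_pos _).le)

theorem measurable_condMean (g : ℝ → ℝ) (n : ℕ) :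
    Measurable fun p : ℝ × (Fin n → ℝ) => condMean ρ θ g p.1 p.2 := by
  have hs : Measurable fun p : ℝ × (Fin n → ℝ) => scores g p.2 :=
    (measurable_scores g n).comp measurable_snd
  have h := (continuous_latentMean (ρ := ρ) (θ := θ) (n := n)).measurable.comp
    ((measurable_fst (α := ℝ) (β := Fin n → ℝ)).prodMk hs)
  exact h

theorem measurable_freqProb (hρ : Reparametrized ρ θ) (h₁₃ : θ.θ₁ ^ 2 + θ.θ₃ ^ 2 < 1)
    (h₂₄ : θ.θ₂ ^ 2 + θ.θ₄ ^ 2 < 1) (f : PMF ℕ) (g : ℝ → ℝ) (n i : ℕ) :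
    Measurable fun p : ℝ × (Fin n → ℝ) => freqProb ρ θ f g i p.1 p.2 :=
  ((measurable_latentFreqCDF hρ h₁₃ h₂₄ n _).comp (measurable_condMean g n)).sub
    ((measurable_latentFreqCDF hρ h₁₃ h₂₄ n _).comp (measurable_condMean g n))

/-- The conditional density given `R = r` of the number of claims and of `n` severities. -/
noncomputable def yearDensity (ρ : Correlations) (θ : FactorParams) (f : PMF ℕ) (g : ℝ → ℝ) {n : ℕ}
    (r : ℝ) (z : ℕ × (Fin n → ℝ)) : ENNReal :=
  ENNReal.ofReal (condSevDensity ρ θ g r z.2) * ENNReal.ofReal (freqProb ρ θ f g z.1 r z.2)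

theorem measurable_yearDensity (hρ : Reparametrized ρ θ) (h₁₃ : θ.θ₁ ^ 2 + θ.θ₃ ^ 2 < 1)
    (h₂₄ : θ.θ₂ ^ 2 + θ.θ₄ ^ 2 < 1) (f : PMF ℕ) {g : ℝ → ℝ} (hg : IsSeverityDensity g) (n : ℕ) :
    Measurable fun p : ℝ × (ℕ × (Fin n → ℝ)) => yearDensity ρ θ f g p.1 p.2 := by
  have hp : Measurable fun p : ℝ × (ℕ × (Fin n → ℝ)) => (p.1, p.2.2) := by fun_prop
  have hF : Measurable fun q : ℕ × (ℝ × (Fin n → ℝ)) => freqProb ρ θ f g q.1 q.2.1 q.2.2 :=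
    measurable_from_prod_countable_right fun i => measurable_freqProb hρ h₁₃ h₂₄ f g n i
  have hq : Measurable fun p : ℝ × (ℕ × (Fin n → ℝ)) => (p.2.1, (p.1, p.2.2)) := by fun_prop
  have h1 := (measurable_condSevDensity (ρ := ρ) (θ := θ) hg n).comp hp
  have h2 := hF.comp hq
  exact (ENNReal.measurable_ofReal.comp h1).mul (ENNReal.measurable_ofReal.comp h2)

theorem lintegral_condSevDensity (hρ : Reparametrized ρ θ) (h₂₄ : θ.θ₂ ^ 2 + θ.θ₄ ^ 2 < 1)
    {g : ℝ → ℝ} (hg : IsSeverityDensity g) (n : ℕ) (r : ℝ) :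
    ∫⁻ y : Fin n → ℝ, ENNReal.ofReal (condSevDensity ρ θ g r y) = 1 := by
  have h1 := lintegral_mvNormalDensity_scores hg (fun _ : Fin n => r * θ.θ₂) (sevCov ρ θ n)
    (F := fun _ => 1) measurable_const
  have h2 := lintegral_multivariateGaussian (fun _ : Fin n => r * θ.θ₂) (sevCov_posDef hρ h₂₄ n)
    (F := fun _ => 1) measurable_const
  rw [← h2, lintegral_one, measure_univ] at h1
  simp only [mul_one] at h1
  exact h1.symm

/-- The joint conditional distribution function of a year given `R = r`. -/
theorem yearNoise_latentYear (hρ : Reparametrized ρ θ) (h₁₃ : θ.θ₁ ^ 2 + θ.θ₃ ^ 2 < 1)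
    (h₂₄ : θ.θ₂ ^ 2 + θ.θ₄ ^ 2 < 1) (f : PMF ℕ) {g : ℝ → ℝ} (hg : IsSeverityDensity g) {n : ℕ}
    (r : ℝ) (m : ℕ) (y₀ : Fin n → ℝ) :
    yearNoise ρ θ n {b | Phi (latentYear ρ θ r b 0) ≤ freqCDF f m ∧
        ∀ j : Fin n, Phi (latentYear ρ θ r b j.succ) ≤ sevCDF g (y₀ j)} =
      ∫⁻ z in Iic m ×ˢ Iic y₀, yearDensity ρ θ f g r z ∂(Measure.count.prod volume) := by
  have hmean : Measurable fun x : Fin n → ℝ => latentMean ρ θ r x :=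
    (continuous_latentMean.comp (by fun_prop : Continuous fun x : Fin n → ℝ => (r, x))).measurable
  let F : (Fin n → ℝ) → ENNReal := fun x =>
    ENNReal.ofReal (latentFreqCDF ρ θ n (freqCDF f m) (latentMean ρ θ r x))
  have hF : Measurable F :=
    ENNReal.measurable_ofReal.comp ((measurable_latentFreqCDF hρ h₁₃ h₂₄ n _).comp hmean)
  let D : Set (Fin n → ℝ) := {x : Fin n → ℝ | ∀ j, Phi (x j) ≤ sevCDF g (y₀ j)}
  have hDm : MeasurableSet D := by
    simp only [D, ofPred_forall]
    exact MeasurableSet.iInter fun j => measurableSet_le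
      (measurable_Phi_coe.comp (measurable_pi_apply j)) measurable_const
  have hyear : ∀ i, Measurable fun b : EuclideanSpace ℝ (Fin n) × ℝ =>
      Phi (latentYear ρ θ r b i) := fun i =>
    measurable_Phi_coe.comp ((measurable_pi_apply i).comp
      (continuous_latentYear.comp (by fun_prop : Continuous
        fun b : EuclideanSpace ℝ (Fin n) × ℝ => (r, b))).measurable)
  have hset : MeasurableSet {b | Phi (latentYear ρ θ r b 0) ≤ freqCDF f m ∧
        ∀ j : Fin n, Phi (latentYear ρ θ r b j.succ) ≤ sevCDF g (y₀ j)} := by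
    have h : MeasurableSet {b : EuclideanSpace ℝ (Fin n) × ℝ |
        ∀ j : Fin n, Phi (latentYear ρ θ r b j.succ) ≤ sevCDF g (y₀ j)} := by
      simp only [ofPred_forall]
      exact MeasurableSet.iInter fun j => measurableSet_le (hyear j.succ) measurable_const
    exact (measurableSet_le (hyear 0) measurable_const).inter h
  -- For fixed severity noise the severity constraints do not involve the frequency error: the slice
  -- is empty or a pure frequency event.
  have hslice : ∀ w, gaussianReal 0 1 (Prod.mk w ⁻¹' {b | Phi (latentYear ρ θ r b 0) ≤ freqCDF f m ∧
        ∀ j : Fin n, Phi (latentYear ρ θ r b j.succ) ≤ sevCDF g (y₀ j)}) =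
      D.indicator F ((fun _ => r * θ.θ₂) + w.ofLp) := by
    intro w
    change gaussianReal 0 1 {e | Phi ((latentMean ρ θ r (latentSev θ r w) + √(condVar ρ θ n) * e : ℝ) :
      EReal) ≤ freqCDF f m ∧ latentSev θ r w ∈ D} = D.indicator F (latentSev θ r w)
    by_cases hw : latentSev θ r w ∈ D
    · simp only [hw, and_true, indicator_of_mem hw, F]
      rw [latentFreqCDF_eq hρ h₁₃ h₂₄, ofReal_measureReal]
    · simp [hw]
  rw [yearNoise, Measure.prod_apply hset]
  simp_rw [hslice]
  rw [lintegral_multivariateGaussian _ (sevCov_posDef hρ h₂₄ n) (hF.indicator hDm),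
    lintegral_mvNormalDensity_indicator hg _ _ _ hF, ← Measure.prod_restrict, lintegral_prod_symm]
  · refine lintegral_congr fun y => ?_
    simp only [yearDensity]
    rw [lintegral_const_mul _ (measurable_of_countable _), lintegral_Iic_freqProb hρ h₁₃ h₂₄]
    rfl
  · exact ((measurable_yearDensity hρ h₁₃ h₂₄ f hg n).comp measurable_prodMk_left).aemeasurable

end Year

end CopulaClaims

namespace CopulaClaims

open Set Filter Topology Matrix

/-! ### The joint law of the random effect, the frequencies and the severities -/

section Law

variable {ρ : Correlations} {θ : FactorParams} {τ : ℕ}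

/-- The joint law of `R` and of `(N_t, Y_{t,1}, …, Y_{t,k_t})`, `t ≤ τ`, given by its density. -/
noncomputable def claimsLaw (ρ : Correlations) (θ : FactorParams) (f : Fin τ → PMF ℕ)
    (g : Fin τ → ℝ → ℝ) (k : Fin τ → ℕ) : Measure (ℝ × ((t : Fin τ) → ℕ × (Fin (k t) → ℝ))) :=
  ((gaussianReal 0 1).prod (Measure.pi fun _ => Measure.count.prod volume)).withDensity
    fun p => ∏ t, yearDensity ρ θ (f t) (g t) p.1 (p.2 t)

/-- Conditional independence of the years: for fixed `r` the density is a product over the years. -/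
theorem claimsLaw_prod_pi (hρ : Reparametrized ρ θ) (h₁₃ : θ.θ₁ ^ 2 + θ.θ₃ ^ 2 < 1)
    (h₂₄ : θ.θ₂ ^ 2 + θ.θ₄ ^ 2 < 1) (f : Fin τ → PMF ℕ) {g : Fin τ → ℝ → ℝ}
    (hg : ∀ t, IsSeverityDensity (g t)) (k : Fin τ → ℕ) {B : Set ℝ} (hB : MeasurableSet B)
    {s : (t : Fin τ) → Set (ℕ × (Fin (k t) → ℝ))} (hs : ∀ t, MeasurableSet (s t)) :
    claimsLaw ρ θ f g k (B ×ˢ univ.pi s) =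
      ∫⁻ r in B, ∏ t, ∫⁻ z in s t, yearDensity ρ θ (f t) (g t) r z ∂(Measure.count.prod volume)
        ∂(gaussianReal 0 1) := by
  have hmeas : Measurable fun p : ℝ × ((t : Fin τ) → ℕ × (Fin (k t) → ℝ)) =>
      ∏ t, yearDensity ρ θ (f t) (g t) p.1 (p.2 t) := by
    refine Finset.measurable_prod Finset.univ fun t _ => ?_
    have h1 : Measurable fun p : ℝ × ((t : Fin τ) → ℕ × (Fin (k t) → ℝ)) => (p.1, p.2 t) := by
      fun_prop
    have h2 := (measurable_yearDensity hρ h₁₃ h₂₄ (f t) (hg t) (k t)).comp h1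
    exact h2
  have hyear : ∀ t r, Measurable fun z : ℕ × (Fin (k t) → ℝ) =>
      yearDensity ρ θ (f t) (g t) r z := fun t r => by
    have h := (measurable_yearDensity hρ h₁₃ h₂₄ (f t) (hg t) (k t)).comp
      (measurable_prodMk_left (x := r))
    exact h
  rw [claimsLaw, withDensity_apply _ (hB.prod (MeasurableSet.univ_pi hs)), ← Measure.prod_restrict,
    lintegral_prod _ hmeas.aemeasurable, Measure.restrict_pi_pi]
  refine lintegral_congr fun r => ?_
  exact lintegral_fin_prod_eq_prod (fun t => (Measure.count.prod volume).restrict (s t))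
    (fun t z => yearDensity ρ θ (f t) (g t) r z) fun t => hyear t r

theorem gaussianCopula_eq {ι : Type*} [Fintype ι] [DecidableEq ι] (S : Matrix ι ι ℝ) (u : ι → ℝ) :
    ENNReal.ofReal (gaussianCopula S u) = multivariateGaussian 0 S {x | ∀ i, Phi (x i) ≤ u i} := by
  rw [gaussianCopula, ofReal_measureReal]
  simp only [coe_le_PhiInv_iff]

theorem measurableSet_setOf_Phi_le {ι : Type*} [Fintype ι] (u : ι → ℝ) :
    MeasurableSet {x : EuclideanSpace ℝ ι | ∀ i, Phi (x i) ≤ u i} := by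
  simp only [ofPred_forall]
  refine MeasurableSet.iInter fun i => measurableSet_le (measurable_Phi_coe.comp ?_) measurable_const
  fun_prop

/-- The Gaussian copula with random effect as an integral of products over the years. -/
theorem gaussianCopula_factorMatrix (hρ : Reparametrized ρ θ) (h₁₃ : θ.θ₁ ^ 2 + θ.θ₃ ^ 2 < 1)
    (h₂₄ : θ.θ₂ ^ 2 + θ.θ₄ ^ 2 < 1) (f : Fin τ → PMF ℕ) {g : Fin τ → ℝ → ℝ}
    (hg : ∀ t, IsSeverityDensity (g t)) (k n : Fin τ → ℕ) (y : (t : Fin τ) → Fin (k t) → ℝ) (a : ℝ) :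
    ENNReal.ofReal (gaussianCopula (factorMatrix ρ θ k) (Sum.elim (fun _ => a) (levels f g n y))) =
      claimsLaw ρ θ f g k ({r : ℝ | Phi r ≤ a} ×ˢ univ.pi fun t => Iic (n t) ×ˢ Iic (y t)) := by
  have hB : MeasurableSet {r : ℝ | Phi r ≤ a} := measurableSet_le measurable_Phi_coe measurable_const
  have hpre : latent ρ θ k ⁻¹' {x | ∀ i, Phi (x i) ≤
        (Sum.elim (fun _ => a) (levels f g n y) : Unit ⊕ Position k → ℝ) i} =
      {b | Phi b.1 ≤ a ∧ ∀ t, Phi (latentYear ρ θ b.1 (b.2 t) 0) ≤ freqCDF (f t) (n t) ∧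
        ∀ j : Fin (k t), Phi (latentYear ρ θ b.1 (b.2 t) j.succ) ≤ sevCDF (g t) (y t j)} := by
    ext b
    simp only [mem_preimage, mem_ofPred_eq, Sum.forall, Sigma.forall, Fin.forall_fin_succ]
    simp only [latent, levels, Sum.elim_inl, Sum.elim_inr, Fin.cases_zero, Fin.cases_succ,
      forall_const]
  rw [gaussianCopula_eq, ← map_latent_noise hρ h₁₃ h₂₄, Measure.map_apply (measurable_latent k)
    (measurableSet_setOf_Phi_le _), claimsLaw_prod_pi hρ h₁₃ h₂₄ f hg k hB
      fun t => measurableSet_Iic.prod measurableSet_Iic, noise, Measure.prod_apply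
      (measurable_latent k (measurableSet_setOf_Phi_le _)), hpre, ← lintegral_indicator hB]
  refine lintegral_congr fun r => ?_
  by_cases hr : r ∈ {r : ℝ | Phi r ≤ a}
  · rw [indicator_of_mem hr]
    simp_rw [← yearNoise_latentYear hρ h₁₃ h₂₄ (f _) (hg _)]
    rw [← Measure.pi_pi]
    congr 1
    ext b
    have hr' : Phi r ≤ a := hr
    simp [hr']
  · rw [indicator_of_notMem hr]
    have hr' : ¬ Phi r ≤ a := hr
    simp [hr']

/-- Since `Φ ≤ 1`, the level `1` puts no constraint on the random effect. -/
theorem gaussianCopula_claimMatrix (hρ : Reparametrized ρ θ) (h₁₃ : θ.θ₁ ^ 2 + θ.θ₃ ^ 2 < 1)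
    (h₂₄ : θ.θ₂ ^ 2 + θ.θ₄ ^ 2 < 1) (k : Fin τ → ℕ) (u : Position k → ℝ) :
    ENNReal.ofReal (gaussianCopula (claimMatrix ρ k) u) =
      ENNReal.ofReal (gaussianCopula (factorMatrix ρ θ k) (Sum.elim (fun _ => 1) u)) := by
  rw [gaussianCopula_eq, gaussianCopula_eq, ← map_inr_multivariateGaussian hρ h₁₃ h₂₄,
    Measure.map_apply (by fun_prop) (measurableSet_setOf_Phi_le _)]
  congr 1
  ext x
  simp [Sum.forall, Phi_le_one]

theorem isDetermining_claims (k : Fin τ → ℕ) :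
    IsDetermining (univ.pi '' univ.pi fun t : Fin τ =>
      image2 (· ×ˢ ·) (range (Iic : ℕ → Set ℕ)) (range (Iic : (Fin (k t) → ℝ) → Set (Fin (k t) → ℝ)))) :=
  IsDetermining.pi fun _ => isDetermining_Iic_nat.prod isDetermining_Iic_pi

variable {Ω : Type*} [MeasurableSpace Ω] {P : Measure Ω} [IsProbabilityMeasure P]
  {N : Fin τ → Ω → ℕ} {Y : Fin τ → ℕ → Ω → ℝ} {f : Fin τ → PMF ℕ} {g : Fin τ → ℝ → ℝ}

theorem measurable_claims (hN : ∀ t, Measurable (N t)) (hY : ∀ t j, Measurable (Y t j))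
    (k : Fin τ → ℕ) : Measurable fun ω t => (N t ω, fun j : Fin (k t) => Y t j ω) :=
  measurable_pi_lambda _ fun t => (hN t).prodMk (measurable_pi_lambda _ fun j => hY t j)

theorem exists_eq_pi_Iic {k : Fin τ → ℕ} {s : Set ((t : Fin τ) → ℕ × (Fin (k t) → ℝ))}
    (hs : s ∈ univ.pi '' univ.pi fun t : Fin τ => image2 (· ×ˢ ·) (range (Iic : ℕ → Set ℕ))
      (range (Iic : (Fin (k t) → ℝ) → Set (Fin (k t) → ℝ)))) :
    ∃ (n : Fin τ → ℕ) (y : (t : Fin τ) → Fin (k t) → ℝ),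
      s = univ.pi fun t => Iic (n t) ×ˢ Iic (y t) := by
  obtain ⟨S, hS, rfl⟩ := hs
  have : ∀ t, ∃ (n : ℕ) (y : Fin (k t) → ℝ), S t = Iic n ×ˢ Iic y := fun t => by
    obtain ⟨_, ⟨n, rfl⟩, _, ⟨y, rfl⟩, h⟩ := hS t (mem_univ t)
    exact ⟨n, y, h.symm⟩
  choose n y h using this
  exact ⟨n, y, by rw [funext h]⟩

/-- Both measures agree on lower orthants: the level `Φ r` for the random effect is the constraint
`R ≤ r`, by strict monotonicity of `Φ`. -/
theorem FactorCopulaModel.map_eq {R : Ω → ℝ} (h : FactorCopulaModel P R N Y f g ρ θ)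
    (hg : ∀ t, IsSeverityDensity (g t)) (hρ : Reparametrized ρ θ)
    (h₁₃ : θ.θ₁ ^ 2 + θ.θ₃ ^ 2 < 1) (h₂₄ : θ.θ₂ ^ 2 + θ.θ₄ ^ 2 < 1) (k : Fin τ → ℕ) :
    P.map (fun ω => (R ω, fun t => (N t ω, fun j : Fin (k t) => Y t j ω))) =
      claimsLaw ρ θ f g k := by
  have hm := h.measurable_effect.prodMk (measurable_claims h.measurable_freq h.measurable_sev k)
  have := Measure.isProbabilityMeasure_map (μ := P) hm.aemeasurable
  refine (isDetermining_Iic_real.prod (isDetermining_claims k)).ext ?_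
  rintro _ ⟨_, ⟨r, rfl⟩, s, hs, rfl⟩
  obtain ⟨n, y, rfl⟩ := exists_eq_pi_Iic hs
  have hB : {x : ℝ | Phi x ≤ Phi r} = Iic r := by
    ext x
    exact strictMono_Phi_coe.le_iff_le
  have hc := gaussianCopula_factorMatrix hρ h₁₃ h₂₄ f hg k n y (Phi r)
  rw [← h.jointCDF, ofReal_measureReal, hB] at hc
  change _ = claimsLaw ρ θ f g k (Iic r ×ˢ _)
  rw [← hc, Measure.map_apply hm (measurableSet_Iic.prod (MeasurableSet.univ_pi fun t =>
    measurableSet_Iic.prod measurableSet_Iic))]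
  congr 1
  ext ω
  simp [Pi.le_def]

theorem GaussianCopulaModel.map_eq (h : GaussianCopulaModel P N Y f g ρ)
    (hg : ∀ t, IsSeverityDensity (g t)) (hρ : Reparametrized ρ θ)
    (h₁₃ : θ.θ₁ ^ 2 + θ.θ₃ ^ 2 < 1) (h₂₄ : θ.θ₂ ^ 2 + θ.θ₄ ^ 2 < 1) (k : Fin τ → ℕ) :
    P.map (fun ω t => (N t ω, fun j : Fin (k t) => Y t j ω)) = (claimsLaw ρ θ f g k).snd := by
  have hm := measurable_claims h.measurable_freq h.measurable_sev k
  have := Measure.isProbabilityMeasure_map (μ := P) hm.aemeasurable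
  refine (isDetermining_claims k).ext fun s hs => ?_
  obtain ⟨n, y, rfl⟩ := exists_eq_pi_Iic hs
  have hms : MeasurableSet (univ.pi fun t => Iic (n t) ×ˢ Iic (y t)) := MeasurableSet.univ_pi fun t =>
    measurableSet_Iic.prod measurableSet_Iic
  have hB : {x : ℝ | Phi x ≤ 1} = univ := by
    ext x
    simp [Phi_le_one]
  have hc := gaussianCopula_factorMatrix hρ h₁₃ h₂₄ f hg k n y 1
  rw [← gaussianCopula_claimMatrix hρ h₁₃ h₂₄, ← h.jointCDF, ofReal_measureReal, hB] at hc
  rw [Measure.snd_apply hms, ← univ_prod, ← hc, Measure.map_apply hm hms]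
  congr 1
  ext ω
  simp [Pi.le_def]

end Law

end CopulaClaims

namespace CopulaClaims

open Set Filter Topology

/-! ### The reference measure of the observed claims -/

theorem lintegral_yearMeasure {q : YearClaims → ENNReal} (hq : Measurable q) :
    ∫⁻ z, q z ∂yearMeasure = ∑' n, ∫⁻ y : Fin n → ℝ, q ⟨n, y⟩ := by
  rw [yearMeasure, lintegral_sum_measure]
  exact tsum_congr fun n => lintegral_map hq (measurable_sigma_mk n)

theorem measurableSet_sigma_mk_image {n : ℕ} {A : Set (Fin n → ℝ)} (hA : MeasurableSet A) :
    MeasurableSet (Sigma.mk n '' A : Set YearClaims) := by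
  have h := (isDetermining_sigma (α := fun n => Fin n → ℝ)).generateFrom_eq
  rw [← h]
  exact MeasurableSpace.measurableSet_generateFrom ⟨n, A, hA, rfl⟩

theorem setLIntegral_yearMeasure {q : YearClaims → ENNReal} (hq : Measurable q) {n : ℕ}
    {A : Set (Fin n → ℝ)} (hA : MeasurableSet A) :
    ∫⁻ z in Sigma.mk n '' A, q z ∂yearMeasure = ∫⁻ y in A, q ⟨n, y⟩ := by
  have hm := measurableSet_sigma_mk_image hA
  rw [← lintegral_indicator hm, lintegral_yearMeasure (hq.indicator hm), tsum_eq_single n,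
    ← lintegral_indicator hA]
  · refine lintegral_congr fun y => ?_
    by_cases hy : y ∈ A
    · rw [indicator_of_mem hy, indicator_of_mem (mem_image_of_mem _ hy)]
    · rw [indicator_of_notMem hy, indicator_of_notMem]
      rintro ⟨y', hy', h⟩
      exact hy (sigma_mk_injective h ▸ hy')
  · intro m hmn
    have h0 : ∀ y : Fin m → ℝ, (Sigma.mk n '' A).indicator q ⟨m, y⟩ = 0 := fun y => by
      refine indicator_of_notMem ?_ _
      rintro ⟨y', -, h⟩
      exact hmn (congrArg Sigma.fst h).symm
    simp [h0]

instance : SigmaFinite yearMeasure := by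
  let S : ℕ × ℕ → Set YearClaims := fun p =>
    Sigma.mk p.1 '' spanningSets (volume : Measure (Fin p.1 → ℝ)) p.2
  refine Measure.sigmaFinite_of_countable (S := range S) (countable_range S) ?_ ?_
  · rintro _ ⟨⟨n, m⟩, rfl⟩
    have h := setLIntegral_yearMeasure (q := fun _ => 1) measurable_const
      (measurableSet_spanningSets (volume : Measure (Fin n → ℝ)) m)
    rw [setLIntegral_one, setLIntegral_one] at h
    exact h ▸ measure_spanningSets_lt_top _ m
  · refine eq_univ_of_forall fun ⟨n, y⟩ => ?_
    have hy : y ∈ ⋃ m, spanningSets (volume : Measure (Fin n → ℝ)) m := by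
      rw [iUnion_spanningSets]; trivial
    obtain ⟨m, hm⟩ := mem_iUnion.1 hy
    exact ⟨_, ⟨⟨n, m⟩, rfl⟩, y, hm, rfl⟩

section Density

variable {ρ : Correlations} {θ : FactorParams} {τ : ℕ}

/-- The conditional density given `R = r` of the observed claims of a year. -/
noncomputable def observedDensity (ρ : Correlations) (θ : FactorParams) (f : PMF ℕ) (g : ℝ → ℝ)
    (r : ℝ) (z : YearClaims) : ENNReal :=
  yearDensity ρ θ f g r (z.1, z.2)

theorem measurable_observedDensity (hρ : Reparametrized ρ θ) (h₁₃ : θ.θ₁ ^ 2 + θ.θ₃ ^ 2 < 1)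
    (h₂₄ : θ.θ₂ ^ 2 + θ.θ₄ ^ 2 < 1) (f : PMF ℕ) {g : ℝ → ℝ} (hg : IsSeverityDensity g) :
    Measurable fun p : ℝ × YearClaims => observedDensity ρ θ f g p.1 p.2 := by
  refine measurable_prod_sigma fun n => ?_
  have h1 : Measurable fun x : ℝ × (Fin n → ℝ) => (x.1, ((n, x.2) : ℕ × (Fin n → ℝ))) := by fun_prop
  have h2 := (measurable_yearDensity hρ h₁₃ h₂₄ f hg n).comp h1
  exact h2

theorem measurable_prod_observedDensity (hρ : Reparametrized ρ θ)
    (h₁₃ : θ.θ₁ ^ 2 + θ.θ₃ ^ 2 < 1) (h₂₄ : θ.θ₂ ^ 2 + θ.θ₄ ^ 2 < 1) (f : Fin τ → PMF ℕ)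
    {g : Fin τ → ℝ → ℝ} (hg : ∀ t, IsSeverityDensity (g t)) :
    Measurable fun p : (Fin τ → YearClaims) × ℝ =>
      ∏ t, observedDensity ρ θ (f t) (g t) p.2 (p.1 t) := by
  refine Finset.measurable_prod Finset.univ fun t _ => ?_
  have h1 : Measurable fun p : (Fin τ → YearClaims) × ℝ => (p.2, p.1 t) := by fun_prop
  have h2 := (measurable_observedDensity hρ h₁₃ h₂₄ (f t) (hg t)).comp h1
  exact h2

theorem prod_nonneg_integrand (hρ : Reparametrized ρ θ)
    (h₁₃ : θ.θ₁ ^ 2 + θ.θ₃ ^ 2 < 1) (h₂₄ : θ.θ₂ ^ 2 + θ.θ₄ ^ 2 < 1) (f : Fin τ → PMF ℕ)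
    {g : Fin τ → ℝ → ℝ} (hg : ∀ t, IsSeverityDensity (g t)) (z : Fin τ → YearClaims) (r : ℝ) (t : Fin τ) :
    0 ≤ condSevDensity ρ θ (g t) r (z t).2 * condFreqProb ρ θ (f t) (g t) r (z t).2 :=
  mul_nonneg (condSevDensity_nonneg (hg t) _ _) (freqProb_nonneg hρ h₁₃ h₂₄ _ _ _ _ _)

theorem condSevDensity_le (hρ : Reparametrized ρ θ) (h₂₄ : θ.θ₂ ^ 2 + θ.θ₄ ^ 2 < 1)
    {g : ℝ → ℝ} (hg : IsSeverityDensity g) {n : ℕ} (r : ℝ) (y : Fin n → ℝ) :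
    condSevDensity ρ θ g r y ≤ (√((2 * Real.pi) ^ n * (sevCov ρ θ n).det))⁻¹ *
      ∏ j, g (y j) / phi (scores g y j) :=
  mul_le_mul_of_nonneg_right (mvNormalDensity_le _ (sevCov_posDef hρ h₂₄ n) _)
    (Finset.prod_nonneg fun _ _ => div_nonneg (hg.nonneg _) (phi_pos _).le)

/-- The severity factors are bounded uniformly in `r` and the frequency factors by `1`, so a
constant multiple of `φ` dominates. This works for every `z`. -/
theorem integrable_densityIntegrand (hρ : Reparametrized ρ θ)
    (h₁₃ : θ.θ₁ ^ 2 + θ.θ₃ ^ 2 < 1) (h₂₄ : θ.θ₂ ^ 2 + θ.θ₄ ^ 2 < 1) (f : Fin τ → PMF ℕ)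
    {g : Fin τ → ℝ → ℝ} (hg : ∀ t, IsSeverityDensity (g t)) (z : Fin τ → YearClaims) :
    Integrable (densityIntegrand ρ θ f g z) := by
  have hphi : Integrable phi := integrable_gaussianPDFReal 0 1
  have hmeas : ∀ t, Measurable fun r =>
      condSevDensity ρ θ (g t) r (z t).2 * condFreqProb ρ θ (f t) (g t) r (z t).2 := fun t => by
    have h1 := (measurable_condSevDensity (ρ := ρ) (θ := θ) (hg t) (z t).1).comp
      (measurable_prodMk_right (y := (z t).2))
    have h2 := (measurable_freqProb hρ h₁₃ h₂₄ (f t) (g t) (z t).1 (z t).1).comp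
      (measurable_prodMk_right (y := (z t).2))
    exact h1.mul h2
  let C : ℝ := ∏ t, (√((2 * Real.pi) ^ (z t).1 * (sevCov ρ θ (z t).1).det))⁻¹ *
      ∏ j, g t ((z t).2 j) / phi (scores (g t) (z t).2 j)
  refine (hphi.const_mul C).mono' ?_ (Eventually.of_forall fun r => ?_)
  · exact ((Finset.measurable_prod Finset.univ fun t _ => hmeas t).mul
      (measurable_gaussianPDFReal 0 1)).aestronglyMeasurable
  · have h0 := prod_nonneg_integrand hρ h₁₃ h₂₄ f hg z r
    rw [densityIntegrand, Real.norm_of_nonneg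
      (mul_nonneg (Finset.prod_nonneg fun t _ => h0 t) (phi_pos r).le)]
    refine mul_le_mul_of_nonneg_right (Finset.prod_le_prod (fun t _ => h0 t) fun t _ => ?_)
      (phi_pos r).le
    exact (mul_le_of_le_one_right (condSevDensity_nonneg (hg t) _ _)
      (freqProb_le_one _ _ _ _ _)).trans (condSevDensity_le hρ h₂₄ (hg t) _ _)

theorem ofReal_integral_densityIntegrand (hρ : Reparametrized ρ θ)
    (h₁₃ : θ.θ₁ ^ 2 + θ.θ₃ ^ 2 < 1) (h₂₄ : θ.θ₂ ^ 2 + θ.θ₄ ^ 2 < 1) (f : Fin τ → PMF ℕ)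
    {g : Fin τ → ℝ → ℝ} (hg : ∀ t, IsSeverityDensity (g t)) (z : Fin τ → YearClaims) :
    ENNReal.ofReal (∫ r, densityIntegrand ρ θ f g z r) =
      ∫⁻ r, ∏ t, observedDensity ρ θ (f t) (g t) r (z t) ∂(gaussianReal 0 1) := by
  have h0 := prod_nonneg_integrand hρ h₁₃ h₂₄ f hg z
  have hm : Measurable fun r => ∏ t, observedDensity ρ θ (f t) (g t) r (z t) := by
    have h := (measurable_prod_observedDensity hρ h₁₃ h₂₄ f hg).comp
      (measurable_prodMk_left (x := z))
    exact h
  rw [ofReal_integral_eq_lintegral_ofReal (integrable_densityIntegrand hρ h₁₃ h₂₄ f hg z)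
    (Eventually.of_forall fun r => mul_nonneg (Finset.prod_nonneg fun t _ => h0 r t) (phi_pos r).le),
    gaussianReal_of_var_ne_zero 0 one_ne_zero,
    lintegral_withDensity_eq_lintegral_mul _ (measurable_gaussianPDF 0 1) hm]
  refine lintegral_congr fun r => ?_
  rw [densityIntegrand, mul_comm, ENNReal.ofReal_mul (phi_pos r).le,
    ENNReal.ofReal_prod_of_nonneg fun t _ => h0 r t]
  simp only [Pi.mul_apply]
  congr 1
  exact Finset.prod_congr rfl fun t _ => ENNReal.ofReal_mul (condSevDensity_nonneg (hg t) _ _)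

theorem setLIntegral_singleton_prod {n : ℕ} (i : ℕ) {A : Set (Fin n → ℝ)}
    {F : ℕ × (Fin n → ℝ) → ENNReal} (hF : Measurable F) :
    ∫⁻ z in {i} ×ˢ A, F z ∂(Measure.count.prod volume) = ∫⁻ y in A, F (i, y) := by
  rw [← Measure.prod_restrict, lintegral_prod _ hF.aemeasurable, Measure.restrict_singleton]
  simp

theorem preimage_observedClaims {Ω : Type*} {N : Fin τ → Ω → ℕ} {Y : Fin τ → ℕ → Ω → ℝ}
    (n : Fin τ → ℕ) (A : (t : Fin τ) → Set (Fin (n t) → ℝ)) :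
    observedClaims N Y ⁻¹' (univ.pi fun t => Sigma.mk (n t) '' A t) =
      (fun ω t => (N t ω, fun j : Fin (n t) => Y t j ω)) ⁻¹' (univ.pi fun t => {n t} ×ˢ A t) := by
  ext ω
  simp only [mem_preimage, mem_univ_pi]
  refine forall_congr' fun t => ?_
  constructor
  · rintro ⟨y, hy, h⟩
    obtain ⟨h1, h2⟩ := Sigma.mk.inj_iff.1 h
    refine ⟨h1.symm, ?_⟩
    -- Replacing `N t ω` by a free `m` allows the substitution that turns the heterogeneous equality
    -- into an equality.
    suffices ∀ m, m = n t → ∀ y : Fin (n t) → ℝ, y ∈ A t → HEq y (fun j : Fin m => Y t j ω) →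
        (fun j : Fin (n t) => Y t j ω) ∈ A t from this _ h1.symm y hy h2
    rintro _ rfl y hy h
    exact eq_of_heq h ▸ hy
  · rintro ⟨h1, h2⟩
    refine ⟨_, h2, ?_⟩
    have h1 : N t ω = n t := h1
    simp only [observedClaims]
    rw [h1]

variable {Ω : Type*} [MeasurableSpace Ω] {P : Measure Ω} [IsProbabilityMeasure P]
  {N : Fin τ → Ω → ℕ} {Y : Fin τ → ℕ → Ω → ℝ} {f : Fin τ → PMF ℕ} {g : Fin τ → ℝ → ℝ}

theorem measurable_observedClaims (hN : ∀ t, Measurable (N t)) (hY : ∀ t j, Measurable (Y t j)) :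
    Measurable (observedClaims N Y) := by
  refine measurable_pi_lambda _ fun t => ?_
  have h := (isDetermining_sigma (α := fun n => Fin n → ℝ)).generateFrom_eq
  rw [← h]
  refine measurable_generateFrom ?_
  rintro _ ⟨n, A, hA, rfl⟩
  have hset : (fun ω => observedClaims N Y ω t) ⁻¹' (Sigma.mk n '' A) =
      {ω | N t ω = n} ∩ (fun ω (j : Fin n) => Y t j ω) ⁻¹' A := by
    have h := preimage_observedClaims (τ := 1) (N := fun _ => N t) (Y := fun _ => Y t)
      (fun _ => n) fun _ => A
    ext ω
    have := Set.ext_iff.1 h ω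
    simpa [observedClaims] using this
  rw [hset]
  have hYt : Measurable fun ω (j : Fin n) => Y t j ω := measurable_pi_lambda _ fun j => hY t j
  exact (hN t (measurableSet_singleton n)).inter (hYt hA)

/-- On a product of sets each inside a single summand, the claim numbers `n` are fixed, so the joint
law with `k = n` severities applies. Tonelli's theorem then moves the integral over `r` outside,
where both sides factor over the years. -/
theorem GaussianCopulaModel.map_observedClaims (h : GaussianCopulaModel P N Y f g ρ)
    (hg : ∀ t, IsSeverityDensity (g t)) (hρ : Reparametrized ρ θ)
    (h₁₃ : θ.θ₁ ^ 2 + θ.θ₃ ^ 2 < 1) (h₂₄ : θ.θ₂ ^ 2 + θ.θ₄ ^ 2 < 1) :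
    P.map (observedClaims N Y) = (claimsMeasure τ).withDensity
      fun z => ENNReal.ofReal (∫ r, densityIntegrand ρ θ f g z r) := by
  have hm := measurable_observedClaims h.measurable_freq h.measurable_sev
  have := Measure.isProbabilityMeasure_map (μ := P) hm.aemeasurable
  simp_rw [ofReal_integral_densityIntegrand hρ h₁₃ h₂₄ f hg]
  refine (IsDetermining.pi fun _ => isDetermining_sigma).ext ?_
  rintro _ ⟨s, hs, rfl⟩
  choose n A hA hsA using fun t => hs t (mem_univ t)
  obtain rfl : s = fun t => Sigma.mk (n t) '' A t := funext hsA
  have hms : MeasurableSet (univ.pi fun t => (Sigma.mk (n t) '' A t : Set YearClaims)) :=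
    MeasurableSet.univ_pi fun t => measurableSet_sigma_mk_image (hA t)
  have hms' : ∀ t, MeasurableSet ({n t} ×ˢ A t) := fun t => (measurableSet_singleton _).prod (hA t)
  have hmp := MeasurableSet.univ_pi hms'
  have hobs : ∀ t r, Measurable fun z => observedDensity ρ θ (f t) (g t) r z := fun t r => by
    have h := (measurable_observedDensity hρ h₁₃ h₂₄ (f t) (hg t)).comp
      (measurable_prodMk_left (x := r))
    exact h
  have hyear : ∀ t r, Measurable fun z : ℕ × (Fin (n t) → ℝ) =>
      yearDensity ρ θ (f t) (g t) r z := fun t r => by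
    have h := (measurable_yearDensity hρ h₁₃ h₂₄ (f t) (hg t) (n t)).comp
      (measurable_prodMk_left (x := r))
    exact h
  rw [Measure.map_apply hm hms, preimage_observedClaims,
    ← Measure.map_apply (measurable_claims h.measurable_freq h.measurable_sev n) hmp,
    h.map_eq hg hρ h₁₃ h₂₄, Measure.snd_apply hmp, ← univ_prod,
    claimsLaw_prod_pi hρ h₁₃ h₂₄ f hg n MeasurableSet.univ hms', Measure.restrict_univ,
    withDensity_apply _ hms, claimsMeasure, Measure.restrict_pi_pi,
    lintegral_lintegral_swap (measurable_prod_observedDensity hρ h₁₃ h₂₄ f hg).aemeasurable]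
  refine lintegral_congr fun r => ?_
  rw [lintegral_fin_prod_eq_prod _ (fun t => observedDensity ρ θ (f t) (g t) r) fun t => hobs t r]
  refine Finset.prod_congr rfl fun t _ => ?_
  rw [setLIntegral_yearMeasure (hobs t r) (hA t), setLIntegral_singleton_prod _ (hyear t r)]
  rfl

end Density

end CopulaClaims

namespace CopulaClaims

open Set Filter Topology

/-! ### Conditional laws given the random effect -/

section Conditional

variable {ρ : Correlations} {θ : FactorParams}

theorem setLIntegral_yearDensity (hρ : Reparametrized ρ θ) (h₁₃ : θ.θ₁ ^ 2 + θ.θ₃ ^ 2 < 1)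
    (h₂₄ : θ.θ₂ ^ 2 + θ.θ₄ ^ 2 < 1) (f : PMF ℕ) {g : ℝ → ℝ} (hg : IsSeverityDensity g) {n : ℕ}
    (r : ℝ) (I : Set ℕ) (A : Set (Fin n → ℝ)) :
    ∫⁻ z in I ×ˢ A, yearDensity ρ θ f g r z ∂(Measure.count.prod volume) =
      ∫⁻ y in A, ENNReal.ofReal (condSevDensity ρ θ g r y) *
        ∫⁻ i in I, ENNReal.ofReal (freqProb ρ θ f g i r y) ∂Measure.count := by
  have hm : Measurable fun z : ℕ × (Fin n → ℝ) => yearDensity ρ θ f g r z := by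
    have h := (measurable_yearDensity hρ h₁₃ h₂₄ f hg n).comp (measurable_prodMk_left (x := r))
    exact h
  rw [← Measure.prod_restrict, lintegral_prod_symm _ hm.aemeasurable]
  refine lintegral_congr fun y => ?_
  simp only [yearDensity]
  exact lintegral_const_mul _
    (measurable_of_countable fun i => ENNReal.ofReal (freqProb ρ θ f g i r y))

theorem setLIntegral_univ_yearDensity (hρ : Reparametrized ρ θ) (h₁₃ : θ.θ₁ ^ 2 + θ.θ₃ ^ 2 < 1)
    (h₂₄ : θ.θ₂ ^ 2 + θ.θ₄ ^ 2 < 1) (f : PMF ℕ) {g : ℝ → ℝ} (hg : IsSeverityDensity g) {n : ℕ}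
    (r : ℝ) (A : Set (Fin n → ℝ)) :
    ∫⁻ z in univ ×ˢ A, yearDensity ρ θ f g r z ∂(Measure.count.prod volume) =
      ∫⁻ y in A, ENNReal.ofReal (condSevDensity ρ θ g r y) := by
  rw [setLIntegral_yearDensity hρ h₁₃ h₂₄ f hg]
  refine lintegral_congr fun y => ?_
  rw [Measure.restrict_univ, lintegral_count, tsum_freqProb hρ h₁₃ h₂₄, mul_one]

theorem measurable_ofReal_condSevDensity {g : ℝ → ℝ} (hg : IsSeverityDensity g) (n : ℕ) :
    Measurable (Function.uncurry fun (r : ℝ) (y : Fin n → ℝ) =>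
      ENNReal.ofReal (condSevDensity ρ θ g r y)) :=
  ENNReal.measurable_ofReal.comp (measurable_condSevDensity hg n)

theorem measurable_ofReal_freqProb (hρ : Reparametrized ρ θ) (h₁₃ : θ.θ₁ ^ 2 + θ.θ₃ ^ 2 < 1)
    (h₂₄ : θ.θ₂ ^ 2 + θ.θ₄ ^ 2 < 1) (f : PMF ℕ) (g : ℝ → ℝ) (n : ℕ) :
    Measurable (Function.uncurry fun (x : ℝ × (Fin n → ℝ)) (i : ℕ) =>
      ENNReal.ofReal (freqProb ρ θ f g i x.1 x.2)) :=
  measurable_from_prod_countable_left fun i =>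
    ENNReal.measurable_ofReal.comp (measurable_freqProb hρ h₁₃ h₂₄ f g n i)

/-- The conditional law of `n` severities of a year given the random effect. -/
noncomputable def sevKernel (ρ : Correlations) (θ : FactorParams) (g : ℝ → ℝ) (n : ℕ) :
    Kernel ℝ (Fin n → ℝ) :=
  (Kernel.const ℝ volume).withDensity fun r y => ENNReal.ofReal (condSevDensity ρ θ g r y)

/-- The conditional law of the number of claims of a year given the random effect and `n`
severities. -/
noncomputable def freqKernel (ρ : Correlations) (θ : FactorParams) (f : PMF ℕ) (g : ℝ → ℝ) (n : ℕ) :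
    Kernel (ℝ × (Fin n → ℝ)) ℕ :=
  (Kernel.const _ Measure.count).withDensity fun x i => ENNReal.ofReal (freqProb ρ θ f g i x.1 x.2)

theorem sevKernel_apply {g : ℝ → ℝ} (hg : IsSeverityDensity g) (n : ℕ) (r : ℝ) :
    sevKernel ρ θ g n r =
      volume.withDensity fun y : Fin n → ℝ => ENNReal.ofReal (condSevDensity ρ θ g r y) := by
  rw [sevKernel, Kernel.withDensity_apply _ (measurable_ofReal_condSevDensity hg n),
    Kernel.const_apply]

theorem freqKernel_apply (hρ : Reparametrized ρ θ) (h₁₃ : θ.θ₁ ^ 2 + θ.θ₃ ^ 2 < 1)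
    (h₂₄ : θ.θ₂ ^ 2 + θ.θ₄ ^ 2 < 1) (f : PMF ℕ) (g : ℝ → ℝ) (n : ℕ) (x : ℝ × (Fin n → ℝ)) :
    freqKernel ρ θ f g n x =
      Measure.count.withDensity fun i => ENNReal.ofReal (freqProb ρ θ f g i x.1 x.2) := by
  rw [freqKernel, Kernel.withDensity_apply _ (measurable_ofReal_freqProb hρ h₁₃ h₂₄ f g n),
    Kernel.const_apply]

theorem isMarkovKernel_sevKernel (hρ : Reparametrized ρ θ) (h₂₄ : θ.θ₂ ^ 2 + θ.θ₄ ^ 2 < 1)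
    {g : ℝ → ℝ} (hg : IsSeverityDensity g) (n : ℕ) : IsMarkovKernel (sevKernel ρ θ g n) :=
  ⟨fun r => ⟨by rw [sevKernel_apply hg, withDensity_apply _ MeasurableSet.univ,
    Measure.restrict_univ, lintegral_condSevDensity hρ h₂₄ hg]⟩⟩

theorem isMarkovKernel_freqKernel (hρ : Reparametrized ρ θ) (h₁₃ : θ.θ₁ ^ 2 + θ.θ₃ ^ 2 < 1)
    (h₂₄ : θ.θ₂ ^ 2 + θ.θ₄ ^ 2 < 1) (f : PMF ℕ) (g : ℝ → ℝ) (n : ℕ) :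
    IsMarkovKernel (freqKernel ρ θ f g n) :=
  ⟨fun x => ⟨by rw [freqKernel_apply hρ h₁₃ h₂₄, withDensity_apply _ MeasurableSet.univ,
    Measure.restrict_univ, lintegral_count, tsum_freqProb hρ h₁₃ h₂₄]⟩⟩

variable {Ω : Type*} [MeasurableSpace Ω] {P : Measure Ω} [IsProbabilityMeasure P] {τ : ℕ}
  {R : Ω → ℝ} {N : Fin τ → Ω → ℕ} {Y : Fin τ → ℕ → Ω → ℝ} {f : Fin τ → PMF ℕ} {g : Fin τ → ℝ → ℝ}

/-- In every other year the density given `R = r` has total mass one and disappears from the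
product. -/
theorem FactorCopulaModel.measure_year (h : FactorCopulaModel P R N Y f g ρ θ)
    (hg : ∀ t, IsSeverityDensity (g t)) (hρ : Reparametrized ρ θ)
    (h₁₃ : θ.θ₁ ^ 2 + θ.θ₃ ^ 2 < 1) (h₂₄ : θ.θ₂ ^ 2 + θ.θ₄ ^ 2 < 1) (t : Fin τ) (n : ℕ)
    {B : Set ℝ} (hB : MeasurableSet B) {I : Set ℕ} {A : Set (Fin n → ℝ)} (hA : MeasurableSet A) :
    P {ω | R ω ∈ B ∧ N t ω ∈ I ∧ (fun j : Fin n => Y t j ω) ∈ A} =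
      ∫⁻ r in B, ∫⁻ z in I ×ˢ A, yearDensity ρ θ (f t) (g t) r z ∂(Measure.count.prod volume)
        ∂(gaussianReal 0 1) := by
  classical
  have hm := h.measurable_effect.prodMk
    (measurable_claims h.measurable_freq h.measurable_sev fun _ => n)
  let s : Fin τ → Set (ℕ × (Fin n → ℝ)) := Function.update (fun _ => univ) t (I ×ˢ A)
  have hs : ∀ u, MeasurableSet (s u) := fun u => by
    rcases eq_or_ne u t with rfl | hu
    · simpa [s] using I.to_countable.measurableSet.prod hA
    · simp [s, hu]
  have hset : {ω | R ω ∈ B ∧ N t ω ∈ I ∧ (fun j : Fin n => Y t j ω) ∈ A} =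
      (fun ω => (R ω, fun t => (N t ω, fun j : Fin n => Y t j ω))) ⁻¹' (B ×ˢ univ.pi s) := by
    ext ω
    have : (∀ u, (N u ω, fun j : Fin n => Y u j ω) ∈ s u) ↔
        N t ω ∈ I ∧ (fun j : Fin n => Y t j ω) ∈ A := by
      constructor
      · intro hu
        simpa [s] using hu t
      · intro ht u
        rcases eq_or_ne u t with rfl | hu
        · simpa [s] using ht
        · simp [s, hu]
    simp only [mem_ofPred_eq, mem_preimage, mem_prod, mem_univ_pi, this]
  rw [hset, ← Measure.map_apply hm (hB.prod (MeasurableSet.univ_pi hs)),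
    h.map_eq hg hρ h₁₃ h₂₄ fun _ => n, claimsLaw_prod_pi hρ h₁₃ h₂₄ f hg _ hB hs]
  refine lintegral_congr fun r => ?_
  rw [Finset.prod_eq_single t]
  · simp [s]
  · intro u _ hu
    have : s u = univ ×ˢ univ := by simp [s, hu]
    rw [this, setLIntegral_univ_yearDensity hρ h₁₃ h₂₄ _ (hg u), Measure.restrict_univ,
      lintegral_condSevDensity hρ h₂₄ (hg u)]
  · exact fun ht => absurd (Finset.mem_univ t) ht

/-- Read off from year `t` with no severities and no constraint on the frequency. -/
theorem FactorCopulaModel.map_effect (h : FactorCopulaModel P R N Y f g ρ θ)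
    (hg : ∀ t, IsSeverityDensity (g t)) (hρ : Reparametrized ρ θ)
    (h₁₃ : θ.θ₁ ^ 2 + θ.θ₃ ^ 2 < 1) (h₂₄ : θ.θ₂ ^ 2 + θ.θ₄ ^ 2 < 1) (t : Fin τ) :
    P.map R = gaussianReal 0 1 := by
  ext B hB
  have hy := h.measure_year hg hρ h₁₃ h₂₄ t 0 hB (I := univ) MeasurableSet.univ
  simp_rw [setLIntegral_univ_yearDensity hρ h₁₃ h₂₄ (f t) (hg t), Measure.restrict_univ,
    lintegral_condSevDensity hρ h₂₄ (hg t)] at hy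
  rw [setLIntegral_one] at hy
  rw [Measure.map_apply h.measurable_effect hB, ← hy]
  congr 1
  ext ω
  simp

theorem FactorCopulaModel.map_effect_sev (h : FactorCopulaModel P R N Y f g ρ θ)
    (hg : ∀ t, IsSeverityDensity (g t)) (hρ : Reparametrized ρ θ)
    (h₁₃ : θ.θ₁ ^ 2 + θ.θ₃ ^ 2 < 1) (h₂₄ : θ.θ₂ ^ 2 + θ.θ₄ ^ 2 < 1) (t : Fin τ) (n : ℕ) :
    P.map (fun ω => (R ω, fun j : Fin n => Y t j ω)) =
      (gaussianReal 0 1) ⊗ₘ sevKernel ρ θ (g t) n := by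
  have := isMarkovKernel_sevKernel hρ h₂₄ (hg t) n
  have hm : Measurable fun ω => (R ω, fun j : Fin n => Y t j ω) :=
    h.measurable_effect.prodMk (measurable_pi_lambda _ fun j => h.measurable_sev t j)
  have := Measure.isProbabilityMeasure_map (μ := P) hm.aemeasurable
  refine (isDetermining_measurableSet.prod isDetermining_measurableSet).ext ?_
  rintro _ ⟨B, hB, A, hA, rfl⟩
  have hB : MeasurableSet B := hB
  have hA : MeasurableSet A := hA
  have hy := h.measure_year hg hρ h₁₃ h₂₄ t n hB (I := univ) hA
  simp_rw [setLIntegral_univ_yearDensity hρ h₁₃ h₂₄ (f t) (hg t)] at hy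
  rw [Measure.map_apply hm (hB.prod hA), Measure.compProd_apply_prod hB hA]
  simp_rw [sevKernel_apply (hg t), withDensity_apply _ hA]
  rw [← hy]
  congr 1
  ext ω
  simp

theorem FactorCopulaModel.map_effect_sev_freq (h : FactorCopulaModel P R N Y f g ρ θ)
    (hg : ∀ t, IsSeverityDensity (g t)) (hρ : Reparametrized ρ θ)
    (h₁₃ : θ.θ₁ ^ 2 + θ.θ₃ ^ 2 < 1) (h₂₄ : θ.θ₂ ^ 2 + θ.θ₄ ^ 2 < 1) (t : Fin τ) (n : ℕ) :
    P.map (fun ω => ((R ω, fun j : Fin n => Y t j ω), N t ω)) =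
      P.map (fun ω => (R ω, fun j : Fin n => Y t j ω)) ⊗ₘ freqKernel ρ θ (f t) (g t) n := by
  have := isMarkovKernel_sevKernel hρ h₂₄ (hg t) n
  have := isMarkovKernel_freqKernel hρ h₁₃ h₂₄ (f t) (g t) n
  have hm' : Measurable fun ω => (R ω, fun j : Fin n => Y t j ω) :=
    h.measurable_effect.prodMk (measurable_pi_lambda _ fun j => h.measurable_sev t j)
  have hm := hm'.prodMk (h.measurable_freq t)
  have := Measure.isProbabilityMeasure_map (μ := P) hm.aemeasurable
  refine ((isDetermining_measurableSet.prod isDetermining_measurableSet).prod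
    isDetermining_measurableSet).ext ?_
  rintro _ ⟨_, ⟨B, hB, A, hA, rfl⟩, I, hI, rfl⟩
  have hB : MeasurableSet B := hB
  have hA : MeasurableSet A := hA
  have hI : MeasurableSet I := hI
  have hy := h.measure_year hg hρ h₁₃ h₂₄ t n hB (I := I) hA
  simp_rw [setLIntegral_yearDensity hρ h₁₃ h₂₄ (f t) (hg t)] at hy
  rw [Measure.map_apply hm ((hB.prod hA).prod hI), Measure.compProd_apply_prod (hB.prod hA) hI,
    h.map_effect_sev hg hρ h₁₃ h₂₄,
    Measure.setLIntegral_compProd (Kernel.measurable_coe _ hI) hB hA]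
  have hset : (fun ω => ((R ω, fun j : Fin n => Y t j ω), N t ω)) ⁻¹' ((B ×ˢ A) ×ˢ I) =
      {ω | R ω ∈ B ∧ N t ω ∈ I ∧ (fun j : Fin n => Y t j ω) ∈ A} := by
    ext ω
    simp only [mem_preimage, mem_prod, mem_ofPred_eq]
    tauto
  rw [hset, hy]
  refine lintegral_congr fun r => ?_
  have hd : Measurable fun y : Fin n → ℝ => ENNReal.ofReal (condSevDensity ρ θ (g t) r y) := by
    have h := (measurable_ofReal_condSevDensity (ρ := ρ) (θ := θ) (hg t) n).comp
      (measurable_prodMk_left (x := r))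
    exact h
  have hk : Measurable fun y : Fin n → ℝ => freqKernel ρ θ (f t) (g t) n (r, y) I :=
    (Kernel.measurable_coe _ hI).comp measurable_prodMk_left
  rw [sevKernel_apply (hg t), setLIntegral_withDensity_eq_setLIntegral_mul _ hd hk hA]
  refine lintegral_congr fun y => ?_
  rw [Pi.mul_apply, freqKernel_apply hρ h₁₃ h₂₄, withDensity_apply _ hI]

end Conditional

end CopulaClaims

/-! ### The joint density and the two conditional laws -/

theorem corollary1 {Ω : Type*} [MeasurableSpace Ω] (P : Measure Ω) [IsProbabilityMeasure P]
    {τ : ℕ} (N : Fin τ → Ω → ℕ) (Y : Fin τ → ℕ → Ω → ℝ)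
    (f : Fin τ → PMF ℕ) (g : Fin τ → ℝ → ℝ) (hg : ∀ t, CopulaClaims.IsSeverityDensity (g t))
    (ρ : CopulaClaims.Correlations) (θ : CopulaClaims.FactorParams)
    (hρ : CopulaClaims.Reparametrized ρ θ)
    (h₁₃ : θ.θ₁ ^ 2 + θ.θ₃ ^ 2 < 1) (h₂₄ : θ.θ₂ ^ 2 + θ.θ₄ ^ 2 < 1)
    (hmodel : CopulaClaims.GaussianCopulaModel P N Y f g ρ) :
    -- the joint density of the observed claims
    (HasPDF (CopulaClaims.observedClaims N Y) P (CopulaClaims.claimsMeasure τ) ∧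
      (∀ z, Integrable (CopulaClaims.densityIntegrand ρ θ f g z)) ∧
      pdf (CopulaClaims.observedClaims N Y) P (CopulaClaims.claimsMeasure τ)
        =ᵐ[CopulaClaims.claimsMeasure τ]
          fun z => ENNReal.ofReal (∫ r, CopulaClaims.densityIntegrand ρ θ f g z r)) ∧
    -- the meaning of the two factors, for a random effect `R`
    (∀ R : Ω → ℝ, CopulaClaims.FactorCopulaModel P R N Y f g ρ θ →
      ∀ (t : Fin τ) (n : ℕ),
        (∀ᵐ r ∂(P.map R),
          condDistrib (fun ω (j : Fin n) => Y t j ω) R P r =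
            volume.withDensity fun y : Fin n → ℝ =>
              ENNReal.ofReal (CopulaClaims.condSevDensity ρ θ (g t) r y)) ∧
        (∀ᵐ x ∂(P.map fun ω => (R ω, fun j : Fin n => Y t j ω)),
          (condDistrib (N t) (fun ω => (R ω, fun j : Fin n => Y t j ω)) P x).real {n} =
            CopulaClaims.condFreqProb ρ θ (f t) (g t) x.1 x.2)) := by
  open CopulaClaims in
  refine ⟨?_, fun R hR t n => ⟨?_, ?_⟩⟩
  · have hm := measurable_observedClaims hmodel.measurable_freq hmodel.measurable_sev
    have hmap := hmodel.map_observedClaims hg hρ h₁₃ h₂₄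
    have hd : Measurable fun z => ENNReal.ofReal (∫ r, densityIntegrand ρ θ f g z r) := by
      simp_rw [ofReal_integral_densityIntegrand hρ h₁₃ h₂₄ f hg]
      exact (measurable_prod_observedDensity hρ h₁₃ h₂₄ f hg).lintegral_prod_right'
    have hpdf := hasPDF_of_map_eq_withDensity hm.aemeasurable _ hd.aemeasurable hmap
    exact ⟨hpdf, integrable_densityIntegrand hρ h₁₃ h₂₄ f hg,
      (pdf.eq_of_map_eq_withDensity _ hd.aemeasurable).1 hmap⟩
  · have hYm : Measurable fun ω (j : Fin n) => Y t j ω :=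
      measurable_pi_lambda _ fun j => hR.measurable_sev t j
    have := isMarkovKernel_sevKernel hρ h₂₄ (hg t) n
    have hc := condDistrib_ae_eq_of_measure_eq_compProd (μ := P) (κ := sevKernel ρ θ (g t) n) R
      hYm.aemeasurable
      (by rw [hR.map_effect_sev hg hρ h₁₃ h₂₄, hR.map_effect hg hρ h₁₃ h₂₄ t])
    filter_upwards [hc] with r hr
    rw [hr, sevKernel_apply (hg t)]
  · have := isMarkovKernel_freqKernel hρ h₁₃ h₂₄ (f t) (g t) n
    have hc := condDistrib_ae_eq_of_measure_eq_compProd (μ := P)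
      (κ := freqKernel ρ θ (f t) (g t) n) (fun ω => (R ω, fun j : Fin n => Y t j ω))
      (hR.measurable_freq t).aemeasurable (hR.map_effect_sev_freq hg hρ h₁₃ h₂₄ t n)
    filter_upwards [hc] with x hx
    rw [hx, freqKernel_apply hρ h₁₃ h₂₄, measureReal_def,
      withDensity_apply _ (measurableSet_singleton n), Measure.restrict_singleton]
    simp only [Measure.count_singleton, one_smul, lintegral_dirac]
    -- The mass at `n` is `freqProb` with `i = n`, which is `condFreqProb` by definition.
    exact ENNReal.toReal_ofReal (freqProb_nonneg hρ h₁₃ h₂₄ _ _ _ _ _)
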